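/- A task graph is a finite directed acyclic graph $G=(V,E)$ with non-negative edge costs $c(e)$ and terminal nodes $s,t$ such that every node lies on a path from $s$ to $t$. Let $d(w)$ be the cost of a cheapest path from $w$ to $t$. For an edge $(v,w)$ let $d_\beta(v,w)=c(v,w)+\beta d(w)$ be the cost perceived by an agent with present bias $\beta\in(0,1]$, and let $d_\beta(v)=\min\{d_\beta(v,w)\mid (v,w)\in E\}$. The agent starts at $s$. At a node $v\neq t$ she quits if $d_\beta(v)>\beta r$, where $r\ge 0$ is the reward placed at $t$; otherwise she traverses some edge $(v,w)$ with $d_\beta(v,w)=d_\beta(v)$, ties being broken arbitrarily. $G$ is motivating for $\beta$ and $r$ if she never quits, however ties are broken. A cost configuration $\tilde c\colon E\to\mathbb{R}_{\ge 0}$ is motivating for $\beta$ and $r$ if the graph with edge costs $c+\tilde c$ is. For a non-empty set $B\subset(0,1]$ that is a finite union of closed intervals, let $r(G,B)$ be the infimum of all rewards $r\ge 0$ admitting one cost configuration that is motivating for every $\beta\in B$. UPB-OPT asks for $r(G,B)$, given $G$ and $B$. Corollary. UPB-OPT admits a polynomial-time $2$-approximation: there is an algorithm that, given a task graph $G$ with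 rational edge costs and a present bias set $B$ as a list of closed intervals with rational end points (all numbers in binary), computes in time polynomial in the length of the input a rational reward $\rho$ and a rational cost configuration $\tilde c$ such that $\tilde c$ is motivating for every $\beta\in B$ under the reward $\rho$ and $$r(G,B)\le\rho\le 2\,r(G,B).$$ -/

import Mathlib

open scoped NNReal NNRat

/-! ### Task graphs and present biased agents -/

/-- A task graph: a finite directed acyclic graph with non-negative edge costs, a start node `s`
and an end node `t`, in which every node lies on a path from `s` to `t`.
Only the values of `cost` on edges matter. -/
structure TaskGraph (V : Type) [Finite V] where
  Adj : V → V → Prop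
  cost : V → V → ℝ≥0
  s : V
  t : V
  acyclic : ∀ v, ¬ Relation.TransGen Adj v v
  on_path : ∀ v, Relation.ReflTransGen Adj s v ∧ Relation.ReflTransGen Adj v t

namespace TaskGraph

variable {V : Type} [Finite V]

/-- `G.PathCost v w x`: some path of `G` from `v` to `w` has total cost `x`. -/
inductive PathCost (G : TaskGraph V) : V → V → ℝ → Prop
  | nil (v : V) : PathCost G v v 0
  | cons {u v w : V} {x : ℝ} :
      G.Adj u v → PathCost G v w x → PathCost G u w ((G.cost u v : ℝ) + x)

/-- `d(v)`: the cost of a cheapest path from `v` to `t`. -/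
noncomputable def dist (G : TaskGraph V) (v : V) : ℝ :=
  sInf {x | G.PathCost v G.t x}

/-- `d_β(v, w) = c(v, w) + β d(w)`: the perceived cost of the edge `(v, w)`. -/
noncomputable def perceivedCost (G : TaskGraph V) (β : ℝ) (v w : V) : ℝ :=
  (G.cost v w : ℝ) + β * G.dist w

/-- `d_β(v)`: the minimum perceived cost at `v`, over all edges leaving `v`. -/
noncomputable def minPerceivedCost (G : TaskGraph V) (β : ℝ) (v : V) : ℝ :=
  sInf {x | ∃ w, G.Adj v w ∧ x = G.perceivedCost β v w}

/-- At `v ≠ t` the agent is motivated if her minimum perceived cost is at most her perceived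
reward `β r`. -/
def MotivatedAt (G : TaskGraph V) (β r : ℝ) (v : V) : Prop :=
  G.minPerceivedCost β v ≤ β * r

/-- The agent with present bias `β` may traverse the edge `(v, w)` when the reward is `r`. -/
def AgentStep (G : TaskGraph V) (β r : ℝ) (v w : V) : Prop :=
  v ≠ G.t ∧ G.MotivatedAt β r v ∧ G.Adj v w ∧ G.perceivedCost β v w = G.minPerceivedCost β v

/-- `G` is motivating for the present bias `β` and the reward `r`: however ties are broken, the
agent starting at `s` never arrives at a node other than `t` where she quits. -/
def Motivating (G : TaskGraph V) (β r : ℝ) : Prop :=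
  ∀ v, Relation.ReflTransGen (G.AgentStep β r) G.s v → v ≠ G.t → G.MotivatedAt β r v

/-- The task graph `G_c̃`, in which the cost configuration `e` has been added to the edge costs. -/
def addCost (G : TaskGraph V) (e : V → V → ℝ≥0) : TaskGraph V :=
  { G with cost := fun v w => G.cost v w + e v w }

/-- The cost configuration `e` is motivating for every `β ∈ B` when the reward is `r`. -/
def MotivatingForAll (G : TaskGraph V) (B : Set ℝ) (e : V → V → ℝ≥0) (r : ℝ) : Prop :=
  ∀ β ∈ B, (G.addCost e).Motivating β r

/-- `r(G, B)`: the infimum of all rewards that admit a cost configuration motivating for all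
`β ∈ B`. -/
noncomputable def optReward (G : TaskGraph V) (B : Set ℝ) : ℝ :=
  sInf {r | 0 ≤ r ∧ ∃ e : V → V → ℝ≥0, G.MotivatingForAll B e r}

end TaskGraph

/-! ### Instances and their encoding -/

/-- An instance of the optimization problem with rational data: a task graph on the nodes
`0, …, n - 1`, given by its matrix of edge costs (`none` for a pair that is not an edge), and a
present bias set, given by a non-empty list of closed subintervals of `(0, 1]`. -/
structure UPBInstance where
  n : ℕ
  cost : Fin n → Fin n → Option ℚ≥0
  s : Fin n
  t : Fin n
  acyclic : ∀ v, ¬ Relation.TransGen (fun u w => (cost u w).isSome) v v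
  on_path : ∀ v, Relation.ReflTransGen (fun u w => (cost u w).isSome) s v ∧
    Relation.ReflTransGen (fun u w => (cost u w).isSome) v t
  intervals : List (ℚ≥0 × ℚ≥0)
  intervals_ne_nil : intervals ≠ []
  intervals_valid : ∀ p ∈ intervals, 0 < p.1 ∧ p.1 ≤ p.2 ∧ p.2 ≤ 1

namespace UPBInstance

/-- The task graph `G` of an instance. -/
noncomputable def graph (I : UPBInstance) : TaskGraph (Fin I.n) where
  Adj u v := (I.cost u v).isSome
  cost u v := (((I.cost u v).getD 0 : ℚ≥0) : ℝ≥0)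
  s := I.s
  t := I.t
  acyclic := I.acyclic
  on_path := I.on_path

/-- The present bias set `B` of an instance: the union of its closed intervals. -/
def biasSet (I : UPBInstance) : Set ℝ :=
  {β | ∃ p ∈ I.intervals, (p.1 : ℝ) ≤ β ∧ β ≤ (p.2 : ℝ)}

/-- Entry of the cost matrix: numerator and denominator, or `0, 0` if there is no edge. -/
def encodeEntry : Option ℚ≥0 → List ℕ
  | none => [0, 0]
  | some q => [q.num, q.den]

/-- The encoding as a list of natural numbers: the number of nodes, `s`, `t`, the number of
intervals, the end points of the intervals, and the cost matrix row by row. -/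
def encode (I : UPBInstance) : List ℕ :=
  [I.n, (I.s : ℕ), (I.t : ℕ), I.intervals.length] ++
  I.intervals.flatMap (fun p => [p.1.num, p.1.den, p.2.num, p.2.den]) ++
  (List.finRange I.n).flatMap (fun u =>
    (List.finRange I.n).flatMap (fun v => encodeEntry (I.cost u v)))

end UPBInstance

/-! ### Random access machines with logarithmic cost -/

namespace RAM

/-- The memory: finitely many of the arrays `σ 0, σ 1, …` are used by a given program. Each array
has cells `0, 1, 2, …` that hold natural numbers. -/
abbrev Mem := ℕ → ℕ → ℕ

/-- Expressions: constants, cells of arrays, and arithmetic operations on natural numbers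
(truncated subtraction and integer division). -/
inductive Exp
  | lit (k : ℕ)
  | load (a : ℕ) (i : Exp)
  | add (x y : Exp)
  | sub (x y : Exp)
  | mul (x y : Exp)
  | div (x y : Exp)

/-- The value of an expression. -/
def Exp.eval (σ : Mem) : Exp → ℕ
  | lit k => k
  | load a i => σ a (i.eval σ)
  | add x y => x.eval σ + y.eval σ
  | sub x y => x.eval σ - y.eval σ
  | mul x y => x.eval σ * y.eval σ
  | div x y => x.eval σ / y.eval σ

/-- The time to evaluate an expression: every operand, address and intermediate result costs one
unit plus its length in binary. -/
def Exp.time (σ : Mem) : Exp → ℕ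
  | lit k => k.size + 1
  | load a i => i.time σ + (σ a (i.eval σ)).size + 1
  | add x y => x.time σ + y.time σ + (x.eval σ + y.eval σ).size + 1
  | sub x y => x.time σ + y.time σ + (x.eval σ - y.eval σ).size + 1
  | mul x y => x.time σ + y.time σ + (x.eval σ * y.eval σ).size + 1
  | div x y => x.time σ + y.time σ + (x.eval σ / y.eval σ).size + 1

/-- Programs. `store a i x` writes the value of `x` into cell `i` of array `a`; a guard is true if
its value is not `0`. -/
inductive Prog
  | skip
  | store (a : ℕ) (i x : Exp)
  | seq (p q : Prog)
  | ite (g : Exp) (p q : Prog)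
  | loop (g : Exp) (p : Prog)

/-- `Exec p σ τ T`: started with memory `σ`, the program `p` halts with memory `τ` after time
exactly `T`. -/
inductive Exec : Prog → Mem → Mem → ℕ → Prop
  | skip (σ : Mem) : Exec .skip σ σ 1
  | store (a : ℕ) (i x : Exp) (σ : Mem) :
      Exec (.store a i x) σ
        (Function.update σ a (Function.update (σ a) (i.eval σ) (x.eval σ)))
        (i.time σ + x.time σ + 1)
  | seq {p q : Prog} {σ τ υ : Mem} {T U : ℕ} :
      Exec p σ τ T → Exec q τ υ U → Exec (.seq p q) σ υ (T + U)
  | ite_true {g : Exp} {p q : Prog} {σ τ : Mem} {T : ℕ} :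
      g.eval σ ≠ 0 → Exec p σ τ T → Exec (.ite g p q) σ τ (g.time σ + T + 1)
  | ite_false {g : Exp} {p q : Prog} {σ τ : Mem} {T : ℕ} :
      g.eval σ = 0 → Exec q σ τ T → Exec (.ite g p q) σ τ (g.time σ + T + 1)
  | loop_done {g : Exp} {p : Prog} {σ : Mem} :
      g.eval σ = 0 → Exec (.loop g p) σ σ (g.time σ + 1)
  | loop_step {g : Exp} {p : Prog} {σ τ υ : Mem} {T U : ℕ} :
      g.eval σ ≠ 0 → Exec p σ τ T → Exec (.loop g p) τ υ U →
        Exec (.loop g p) σ υ (g.time σ + T + U + 1)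

/-- The initial memory: the input is stored in array `0`, and all other cells are `0`. -/
def init (x : List ℕ) : Mem := fun a i => if a = 0 then x.getD i 0 else 0

/-- The length of an input: the total number of binary digits, plus one separator per entry. -/
def inputSize (x : List ℕ) : ℕ := (x.map fun k => k.size + 1).sum

/-- The output array `1` holds the rational number `q` at position `i`, as a numerator followed by
a non-zero denominator. -/
def OutputsRat (σ : Mem) (i : ℕ) (q : ℚ≥0) : Prop :=
  σ 1 (i + 1) ≠ 0 ∧ q = (σ 1 i : ℚ≥0) / (σ 1 (i + 1) : ℚ≥0)

end RAM

/-!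
Let `b = min B`, let `d` be the distance to `t`, and let `q` be the minmax value of the paths from
`s` to `t`, where an edge `(v, w)` has the value `c(v, w) / b + d(w)`. The algorithm outputs the
reward `2 q`.

*Lower bound* (`TaskGraph.le_of_motivating`). An agent with present bias `b` who is never stopped
walks to `t` along edges of perceived cost at most `b r`. Charges only increase costs, hence all
these edges have value at most `r`, and `q ≤ r`.

*Upper bound* (`TaskGraph.motivating_of_potential`). Let `S` be the set of nodes from which `t` can
be reached along *good* edges, those of value at most `q`. Charge nothing for the good edges inside
`S`; outside `S` let only the edges of cheapest paths be free of charge; charge for leaving `S` along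
the first edge of a cheapest path at `v` just as much as is needed for the cost of reaching `t` that
way to be `2 d(v)`; block everything else. The new distances `D` satisfy `D ≤ 2 d`. In `S`, an agent
with present bias `β ≥ b` perceives a cost of at most `c(v, w) + 2 β d(w) ≤ 2 β q` along a good edge.
If she leaves `S` for a node `u`, then the charge tells us that `2 d(u) - (1 - β) D(u) ≤ 2 β q`.
This inequality is inherited along the edges of cheapest paths, and it implies that she is
motivated: for a cheapest first edge `(u, x)` with `D(u) = c(u, x) + D(x)` the left-hand side is at
least `c(u, x) + β D(x)`, since `2 d(u) = 2 c(u, x) + 2 d(x) ≥ 2 c(u, x) + D(x)`. So one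
configuration serves all `β ∈ [b, 1]`.

*Computation.* With the product `scale` of all non-zero numbers of the input as common denominator,
everything is done in integers of polynomial length. The distances `d`, the minmax values, and `D`
are solutions of recursions `x v = min (init v) (min_w (F v w (x w)))` over an acyclic graph, and `n`
rounds of iteration solve these (`rounds_stationary`). The program is a sequence of
loops, each of which fills one array by a single expression in the loop counter and the entries
written before; minima and case distinctions are expressed by truncated subtraction. So one
specification with a time bound, `RAM.exec_fill`, covers all loops. The length of every intermediate
result of an expression is bounded in terms of the expression and of the lengths of the numbers in
memory (`RAM.Exp.time_le`), so that for the time bound it suffices to bound the table entries.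
-/

/-! ### Cheapest paths and present biased agents -/

/-- A finite acyclic relation has a rank function that decreases along it: the number of proper
descendants. -/
lemma exists_rank_lt_of_acyclic {V : Type*} [Finite V] {r : V → V → Prop}
    (hr : ∀ v, ¬ Relation.TransGen r v v) :
    ∃ ρ : V → ℕ, (∀ v w, r v w → ρ w < ρ v) ∧ ∀ v, ρ v < Nat.card V := by
  refine ⟨fun v => {x | Relation.TransGen r v x}.ncard, fun v w h => ?_, fun v => ?_⟩
  · refine Set.ncard_lt_ncard ⟨fun x hx => Relation.TransGen.head h hx, fun hsub => ?_⟩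
    exact hr w (hsub (Relation.TransGen.single h))
  · rw [← Set.ncard_univ]
    exact Set.ncard_lt_ncard ⟨Set.subset_univ _, fun hsub => hr v (hsub (Set.mem_univ v))⟩

namespace TaskGraph

variable {V : Type} [Finite V]

lemma exists_adj (G : TaskGraph V) {v : V} (hv : v ≠ G.t) : ∃ w, G.Adj v w := by
  rcases Relation.ReflTransGen.cases_head (G.on_path v).2 with h | ⟨w, h, _⟩
  · exact absurd h hv
  · exact ⟨w, h⟩

/-- Induction from the end node `t` backwards along the edges. -/
lemma induction_of_adj (G : TaskGraph V) {P : V → Prop}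
    (h : ∀ v, (∀ w, G.Adj v w → P w) → P v) (v : V) : P v := by
  obtain ⟨ρ, hρ, -⟩ := exists_rank_lt_of_acyclic G.acyclic
  induction hk : ρ v using Nat.strong_induction_on generalizing v with
  | _ k ih => exact h v fun w hw => ih (ρ w) (hk ▸ hρ v w hw) w rfl

lemma PathCost.nonneg {G : TaskGraph V} {v w : V} {x : ℝ} (h : G.PathCost v w x) : 0 ≤ x := by
  induction h with
  | nil => exact le_rfl
  | cons _ _ ih => exact add_nonneg (NNReal.coe_nonneg _) ih

lemma exists_pathCost (G : TaskGraph V) (v : V) : ∃ x, G.PathCost v G.t x := by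
  induction (G.on_path v).2 using Relation.ReflTransGen.head_induction_on with
  | refl => exact ⟨0, .nil _⟩
  | head h _ ih => exact ih.elim fun x hx => ⟨_, .cons h hx⟩

/-- A potential that satisfies the Bellman equations is the distance to `t`. -/
lemma dist_eq_of_bellman (G : TaskGraph V) (D : V → ℝ) (ht : D G.t = 0)
    (hle : ∀ v w, G.Adj v w → D v ≤ G.cost v w + D w)
    (hex : ∀ v, v ≠ G.t → ∃ w, G.Adj v w ∧ D v = G.cost v w + D w) (v : V) :
    G.dist v = D v := by
  have hlow : ∀ v w x, G.PathCost v w x → w = G.t → D v ≤ x := by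
    intro v w x h
    induction h with
    | nil v => rintro rfl; exact ht.le
    | cons h _ ih => exact fun hw => (hle _ _ h).trans (by linarith [ih hw])
  have hpath : ∀ v, G.PathCost v G.t (D v) := by
    refine G.induction_of_adj fun v ih => ?_
    by_cases hv : v = G.t
    · subst hv; rw [ht]; exact .nil _
    · obtain ⟨w, hw, h⟩ := hex v hv
      rw [h]; exact .cons hw (ih w hw)
  exact IsLeast.csInf_eq ⟨hpath v, fun x hx => hlow v _ x hx rfl⟩

/-- Additional costs do not shorten any path. -/
lemma dist_le_dist_addCost (G : TaskGraph V) (e : V → V → ℝ≥0) (v : V) :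
    G.dist v ≤ (G.addCost e).dist v := by
  refine le_csInf ((G.addCost e).exists_pathCost v) fun y hy => ?_
  have key : ∀ v w y, (G.addCost e).PathCost v w y → ∃ x ≤ y, G.PathCost v w x := by
    intro v w y h
    induction h with
    | nil v => exact ⟨0, le_rfl, .nil _⟩
    | @cons u v w z h _ ih =>
      obtain ⟨x, hx, hp⟩ := ih
      refine ⟨_, ?_, .cons h hp⟩
      have : (((G.addCost e).cost u v : ℝ≥0) : ℝ) = G.cost u v + e u v := NNReal.coe_add _ _
      have := (e u v).coe_nonneg
      linarith
  obtain ⟨x, hx, hp⟩ := key v _ y hy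
  exact (csInf_le ⟨0, fun _ h => PathCost.nonneg h⟩ hp).trans hx

lemma finite_perceivedCosts (G : TaskGraph V) (β : ℝ) (v : V) :
    {x | ∃ w, G.Adj v w ∧ x = G.perceivedCost β v w}.Finite :=
  (Set.finite_range (G.perceivedCost β v)).subset (by rintro _ ⟨w, _, rfl⟩; exact ⟨w, rfl⟩)

lemma minPerceivedCost_le (G : TaskGraph V) (β : ℝ) {v w : V} (h : G.Adj v w) :
    G.minPerceivedCost β v ≤ G.perceivedCost β v w :=
  csInf_le (G.finite_perceivedCosts β v).bddBelow ⟨w, h, rfl⟩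

lemma exists_perceivedCost_eq_min (G : TaskGraph V) (β : ℝ) {v : V} (hv : v ≠ G.t) :
    ∃ w, G.Adj v w ∧ G.perceivedCost β v w = G.minPerceivedCost β v := by
  obtain ⟨w, hw⟩ := G.exists_adj hv
  obtain ⟨w', h, he⟩ := Set.Nonempty.csInf_mem
    (s := {x | ∃ w, G.Adj v w ∧ x = G.perceivedCost β v w}) ⟨_, w, hw, rfl⟩
    (G.finite_perceivedCosts β v)
  exact ⟨w', h, he.symm⟩

/-- The lower bound on motivating rewards. If `h` is at most the minmax value of the paths to `t`,
where an edge `(v, w)` has the value `c(v, w) / b + d(w)`, then no cost configuration motivates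
the agent with present bias `b` for less than `h s`: the agent herself walks along a path whose
edges have value at most `r`. -/
lemma le_of_motivating (G : TaskGraph V) (e : V → V → ℝ≥0) {b r : ℝ} (hb : 0 < b) (hr : 0 ≤ r)
    (hmot : (G.addCost e).Motivating b r) (h : V → ℝ) (ht : h G.t ≤ 0)
    (hstep : ∀ v w, G.Adj v w → h v ≤ max (G.cost v w / b + G.dist w) (h w)) :
    h G.s ≤ r := by
  suffices H : ∀ v, Relation.ReflTransGen ((G.addCost e).AgentStep b r) G.s v → h v ≤ r from
    H _ .refl
  refine G.induction_of_adj fun v ih hv => ?_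
  by_cases hvt : v = G.t
  · subst hvt; linarith
  have hm := hmot v hv hvt
  obtain ⟨w, hw, hmin⟩ := (G.addCost e).exists_perceivedCost_eq_min b (v := v) hvt
  refine (hstep v w hw).trans (max_le ?_ (ih w hw (hv.tail ⟨hvt, hm, hw, hmin⟩)))
  have h1 : (G.addCost e).perceivedCost b v w ≤ b * r := hmin.trans_le hm
  have h2 : (((G.addCost e).cost v w : ℝ≥0) : ℝ) = G.cost v w + e v w := NNReal.coe_add _ _
  have h3 := mul_le_mul_of_nonneg_left (G.dist_le_dist_addCost e w) hb.le
  have h4 := (e v w).coe_nonneg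
  unfold perceivedCost at h1
  rw [div_add' _ _ _ hb.ne', div_le_iff₀ hb]
  nlinarith

/-- The upper bound on motivating rewards. `S` is a set of nodes containing `s` from which one can
go on inside `S` along *good* edges, those with `c(v, w) / b + d(w) ≤ q`. The configuration `e`
makes `D` the new distance to `t`, where `D ≤ 2 d`. It charges nothing for good edges inside `S`
and for cheapest edges outside `S`, leaving `S` along a cheapest edge at `v` is charged so much that
`t` is at distance `2 d(v)` that way, and all other edges are blocked. Then every agent who is at
least as patient as `b` is motivated by the reward `2 q`. -/
lemma motivating_of_potential (G : TaskGraph V) (e : V → V → ℝ≥0) (S : V → Prop) (d D : V → ℝ)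
    {b q β : ℝ} (hb : 0 < b) (hbβ : b ≤ β) (hβ : β ≤ 1)
    (hD0 : ∀ v, 0 ≤ D v) (hDt : D G.t = 0) (hD2 : ∀ v, D v ≤ 2 * d v) (hs : S G.s)
    (hgood : ∀ v, v ≠ G.t → S v →
      ∃ w, G.Adj v w ∧ e v w = 0 ∧ G.cost v w + b * d w ≤ b * q)
    (hle : ∀ v w, G.Adj v w → D v ≤ G.cost v w + e v w + D w)
    (hex : ∀ v, v ≠ G.t → ∃ w, G.Adj v w ∧ D v = G.cost v w + e v w + D w)
    (hedge : ∀ v w, G.Adj v w →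
      (S v ∧ S w ∧ e v w = 0) ∨
      (¬ S v ∧ G.cost v w + d w = d v ∧ e v w = 0) ∨
      (S v ∧ G.cost v w + d w = d v ∧ G.cost v w + e v w + D w = 2 * d v) ∨
      (2 * q < e v w ∧ D v < e v w)) :
    (G.addCost e).Motivating β (2 * q) := by
  have hβ0 : 0 < β := hb.trans_le hbβ
  have hd0 : ∀ v, 0 ≤ d v := fun v => by linarith [hD0 v, hD2 v]
  have hcost : ∀ v w, (((G.addCost e).cost v w : ℝ≥0) : ℝ) = G.cost v w + e v w :=
    fun v w => NNReal.coe_add _ _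
  have hdist : ∀ v, (G.addCost e).dist v = D v := by
    refine (G.addCost e).dist_eq_of_bellman D hDt ?_ ?_
    · intro v w hvw; rw [hcost]; exact hle v w hvw
    · intro v hv; obtain ⟨w, hw, h⟩ := hex v hv; exact ⟨w, hw, by rw [hcost]; exact h⟩
  have hperc : ∀ v w, (G.addCost e).perceivedCost β v w = G.cost v w + e v w + β * D w := by
    intro v w; rw [perceivedCost, hcost, hdist]
  -- A node at which the agent may be: one in `S`, or one satisfying the inequality that she must
  -- have considered true when she left `S`.
  let Ok : V → Prop := fun v => S v ∨ 2 * d v - (1 - β) * D v ≤ β * (2 * q)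
  have hmot : ∀ v, v ≠ G.t → Ok v → (G.addCost e).MotivatedAt β (2 * q) v := by
    intro v hv hok
    by_cases hSv : S v
    · obtain ⟨w, hw, he, hg⟩ := hgood v hv hSv
      refine ((G.addCost e).minPerceivedCost_le β (v := v) (w := w) hw).trans ?_
      rw [hperc, he, NNReal.coe_zero]
      have hc := (G.cost v w).coe_nonneg
      have hdq : d w ≤ q := by
        by_contra hlt
        have := mul_lt_mul_of_pos_left (not_le.1 hlt) hb
        linarith
      have h1 : b * (q - d w) ≤ β * (q - d w) := mul_le_mul_of_nonneg_right hbβ (by linarith)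
      have h2 : β * D w ≤ β * (2 * d w) := mul_le_mul_of_nonneg_left (hD2 w) hβ0.le
      have h3 : β * d w ≤ β * q := mul_le_mul_of_nonneg_left hdq hβ0.le
      nlinarith
    · have hok' := hok.resolve_left hSv
      obtain ⟨w, hw, hDw⟩ := hex v hv
      refine ((G.addCost e).minPerceivedCost_le β (v := v) (w := w) hw).trans ?_
      rw [hperc]
      rcases hedge v w hw with ⟨h, -⟩ | ⟨-, ht, he⟩ | ⟨h, -⟩ | ⟨-, h⟩
      · exact absurd h hSv
      · rw [he, NNReal.coe_zero] at hDw ⊢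
        have hc := mul_nonneg hβ0.le (G.cost v w).coe_nonneg
        have := hD2 w
        nlinarith
      · exact absurd h hSv
      · linarith [(G.cost v w).coe_nonneg, hD0 w]
  have hstep : ∀ v w, Ok v → (G.addCost e).AgentStep β (2 * q) v w → Ok w := by
    rintro v w hok ⟨hvt, hm, hw, hmin⟩
    have hw' : G.Adj v w := hw
    have hp : G.cost v w + e v w + β * D w ≤ β * (2 * q) := by
      rw [← hperc]; exact hmin.trans_le hm
    have hc := (G.cost v w).coe_nonneg
    have hβc := mul_nonneg hβ0.le hc
    rcases hedge v w hw' with ⟨-, h, -⟩ | ⟨hSv, ht, he⟩ | ⟨-, ht, h⟩ | ⟨h, -⟩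
    · exact .inl h
    · right
      have h1 := hok.resolve_left hSv
      have h2 := hle v w hw'
      rw [he, NNReal.coe_zero] at h2
      have h3 : (1 - β) * D v ≤ (1 - β) * (G.cost v w + 0 + D w) :=
        mul_le_mul_of_nonneg_left h2 (by linarith)
      nlinarith
    · right
      nlinarith
    · -- A blocked edge costs more than the reward.
      exfalso
      have h1 := mul_nonneg hβ0.le (hD0 w)
      have hq : 0 ≤ q := by
        by_contra hq
        have : β * (2 * q) < 0 := mul_neg_of_pos_of_neg hβ0 (by linarith)
        linarith [(e v w).coe_nonneg]
      have h2 : β * (2 * q) ≤ 1 * (2 * q) := mul_le_mul_of_nonneg_right hβ (by linarith)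
      linarith
  intro v hv hvt
  refine hmot v hvt ?_
  clear hvt
  induction hv with
  | refl => exact .inl hs
  | tail _ h ih => exact hstep _ _ ih h

end TaskGraph

/-! ### Running times of expressions and table-filling loops -/

namespace RAM

/-- A size measure for expressions: if all cells are less than `2 ^ m`, then the value of `x` is
less than `2 ^ (x.weight * m)`. -/
def Exp.weight : Exp → ℕ
  | lit k => k.size + 1
  | load _ i => i.weight + 1
  | add x y => x.weight + y.weight + 1
  | sub x y => x.weight + y.weight + 1
  | mul x y => x.weight + y.weight + 1
  | div x y => x.weight + y.weight + 1

lemma Exp.eval_lt (σ : Mem) {m : ℕ} (hm : 1 ≤ m) (hσ : ∀ a i, σ a i < 2 ^ m) (x : Exp) :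
    x.eval σ < 2 ^ (x.weight * m) := by
  have two_pow_mul (a b : ℕ) : 2 ^ (a * m) * 2 ^ (b * m) ≤ 2 ^ ((a + b + 1) * m) := by
    rw [← pow_add]; exact Nat.pow_le_pow_right two_pos (by nlinarith)
  have left (a b : ℕ) : 2 ^ (a * m) ≤ 2 ^ ((a + b + 1) * m) :=
    Nat.pow_le_pow_right two_pos (by nlinarith)
  induction x with
  | lit k =>
    refine (Nat.lt_size_self k).trans_le (Nat.pow_le_pow_right two_pos ?_)
    simp only [weight]; nlinarith
  | load a i ih =>
    refine (hσ a _).trans_le (Nat.pow_le_pow_right two_pos ?_)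
    simp only [weight]; nlinarith
  | add x y ihx ihy =>
    have h1 := left x.weight y.weight
    have h2 : 2 ^ (x.weight * m) + 2 ^ (y.weight * m) ≤ 2 ^ ((x.weight + y.weight + 1) * m) := by
      have hx : 2 ^ (x.weight * m) ≤ 2 ^ ((x.weight + y.weight) * m) :=
        Nat.pow_le_pow_right two_pos (by nlinarith)
      have hy : 2 ^ (y.weight * m) ≤ 2 ^ ((x.weight + y.weight) * m) :=
        Nat.pow_le_pow_right two_pos (by nlinarith)
      have h3 : 2 ^ ((x.weight + y.weight) * m + 1) ≤ 2 ^ ((x.weight + y.weight + 1) * m) :=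
        Nat.pow_le_pow_right two_pos (by nlinarith)
      rw [pow_succ] at h3
      omega
    simp only [eval, weight]
    omega
  | sub x y ihx ihy =>
    exact ((Nat.sub_le _ _).trans_lt ihx).trans_le (left _ _)
  | mul x y ihx ihy =>
    exact (Nat.mul_lt_mul'' ihx ihy).trans_le (two_pow_mul _ _)
  | div x y ihx ihy =>
    exact ((Nat.div_le_self _ _).trans_lt ihx).trans_le (left _ _)

lemma Exp.time_le (σ : Mem) {m : ℕ} (hm : 1 ≤ m) (hσ : ∀ a i, σ a i < 2 ^ m) (x : Exp) :
    x.time σ ≤ x.weight * (x.weight * m + 1) := by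
  have hsize (x : Exp) : (x.eval σ).size ≤ x.weight * m := Nat.size_le.2 (x.eval_lt σ hm hσ)
  have node (a b k : ℕ) (hk : k ≤ (a + b + 1) * m) :
      a * (a * m + 1) + b * (b * m + 1) + k + 1 ≤ (a + b + 1) * ((a + b + 1) * m + 1) := by
    nlinarith [Nat.zero_le (a * b * m), Nat.zero_le (a * m), Nat.zero_le (b * m)]
  induction x with
  | lit k => simp only [time, weight]; nlinarith [Nat.zero_le (k.size * k.size * m)]
  | load a i ih =>
    have := node i.weight 0 _ (hsize (.load a i))
    simp only [time, weight, Exp.eval, add_zero, zero_mul] at this ⊢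
    omega
  | add x y ihx ihy =>
    have := node x.weight y.weight _ (hsize (.add x y))
    simp only [time, weight, Exp.eval] at this ⊢
    omega
  | sub x y ihx ihy =>
    have := node x.weight y.weight _ (hsize (.sub x y))
    simp only [time, weight, Exp.eval] at this ⊢
    omega
  | mul x y ihx ihy =>
    have := node x.weight y.weight _ (hsize (.mul x y))
    simp only [time, weight, Exp.eval] at this ⊢
    omega
  | div x y ihx ihy =>
    have := node x.weight y.weight _ (hsize (.div x y))
    simp only [time, weight, Exp.eval] at this ⊢
    omega

/-- The loop counter: cell `0` of array `2`. -/
def counter : Exp := .load 2 (.lit 0)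

/-- The loop that stores the value of `body` in the cells `0, 1, …, bound - 1` of array `a`. The
expression `body` may refer to the counter and to the cells already filled. -/
def fill (a : ℕ) (bound body : Exp) : Prog :=
  .seq (.store 2 (.lit 0) (.lit 0))
    (.loop (.sub bound counter)
      (.seq (.store a counter body) (.store 2 (.lit 0) (.add counter (.lit 1)))))

/-- A factor of the running time of `fill` that depends on the program text only. -/
def fillWeight (bound body : Exp) : ℕ :=
  (bound.weight + 3) * (bound.weight + 3) + body.weight * body.weight + body.weight + 40

/-- Bound on the time of one pass through the loop of `fill`, with slack for its guard. -/
lemma fill_time_aux {W V m tg tb : ℕ} (hm : 1 ≤ m) (hg : tg ≤ (W + 3) * ((W + 3) * m + 1))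
    (hb : tb ≤ V * (V * m + 1)) :
    tg + (3 * m + 30 + tb) ≤ 2 * (((W + 3) * (W + 3) + V * V + V + 40) * m) := by
  have h1 : V ≤ V * m := Nat.le_mul_of_pos_right _ hm
  have h2 : W + 3 ≤ (W + 3) * (W + 3) * m := by nlinarith [Nat.zero_le (W * W), Nat.zero_le W]
  nlinarith [Nat.zero_le (V * V * m)]

/-- The specification of `fill`: if `body` evaluates to `g j` whenever the counter is `j` and the
cells before `j` hold `g`, then the loop fills array `a` with `g`, changes no other array but that
of the counter, and its time is bounded by the number of cells times the length of the numbers. -/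
lemma exec_fill {a : ℕ} (ha : a ≠ 2) {bound body : Exp} {σ : Mem} {m B : ℕ} {g : ℕ → ℕ}
    (hm : 1 ≤ m) (hσ : ∀ a i, σ a i < 2 ^ m) (hB : B < 2 ^ m) (hg : ∀ j < B, g j < 2 ^ m)
    (hbound : ∀ τ : Mem, (∀ c, c ≠ a → c ≠ 2 → τ c = σ c) → bound.eval τ = B)
    (hbody : ∀ j < B, ∀ τ : Mem, (∀ c, c ≠ a → c ≠ 2 → τ c = σ c) → τ 2 0 = j →
      (∀ i < j, τ a i = g i) → body.eval τ = g j) :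
    ∃ τ T, Exec (fill a bound body) σ τ T ∧ T ≤ 2 * fillWeight bound body * m * (B + 2) ∧
      (∀ b i, τ b i < 2 ^ m) ∧ (∀ c, c ≠ a → c ≠ 2 → τ c = σ c) ∧ ∀ i < B, τ a i = g i := by
  have hpos : 0 < 2 ^ m := Nat.two_pow_pos m
  have hweight : (Exp.sub bound counter).weight = bound.weight + 3 := by
    simp [Exp.weight, counter]
  have loop : ∀ k j, j + k = B → ∀ υ : Mem, (∀ b i, υ b i < 2 ^ m) →
      (∀ c, c ≠ a → c ≠ 2 → υ c = σ c) → υ 2 0 = j → (∀ i < j, υ a i = g i) →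
      ∃ τ T, Exec (.loop (.sub bound counter)
          (.seq (.store a counter body) (.store 2 (.lit 0) (.add counter (.lit 1))))) υ τ T ∧
        T ≤ 2 * fillWeight bound body * m * (k + 1) ∧ (∀ b i, τ b i < 2 ^ m) ∧
        (∀ c, c ≠ a → c ≠ 2 → τ c = σ c) ∧ ∀ i < B, τ a i = g i := by
    intro k
    induction k with
    | zero =>
      intro j hj υ hυ hfr hc hfill
      have hguard : (Exp.sub bound counter).eval υ = 0 := by
        simp only [Exp.eval, counter, hbound υ hfr, hc]; omega
      refine ⟨υ, _, .loop_done hguard, ?_, hυ, hfr, fun i hi => hfill i (by omega)⟩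
      have h1 := (Exp.sub bound counter).time_le υ hm hυ
      rw [hweight] at h1
      have h2 := fill_time_aux (V := body.weight) hm h1 (Nat.zero_le _)
      rw [fillWeight]
      linarith
    | succ k ih =>
      intro j hj υ hυ hfr hc hfill
      have hbv := hbody j (by omega) υ hfr hc hfill
      have hguard : (Exp.sub bound counter).eval υ ≠ 0 := by
        simp only [Exp.eval, counter, hbound υ hfr, hc]; omega
      set υ' : Mem := Function.update υ a (Function.update (υ a) j (g j)) with hυ'
      have hυ'2 : υ' 2 = υ 2 := Function.update_of_ne ha.symm _ _
      have hυ'b : ∀ b i, υ' b i < 2 ^ m := by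
        intro b i
        by_cases hb : b = a
        · subst hb
          by_cases hi : i = j
          · subst hi; simpa [hυ'] using hg i (by omega)
          · simpa [hυ', hi] using hυ b i
        · simpa [hυ', hb] using hυ b i
      have e1 : Exec (.store a counter body) υ υ' (counter.time υ + body.time υ + 1) := by
        have := Exec.store a counter body υ
        rwa [show counter.eval υ = j from hc, hbv] at this
      set υ'' : Mem := Function.update υ' 2 (Function.update (υ' 2) 0 (j + 1)) with hυ''
      have e2 : Exec (.store 2 (.lit 0) (.add counter (.lit 1))) υ' υ''
          ((Exp.lit 0).time υ' + (Exp.add counter (.lit 1)).time υ' + 1) := by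
        have := Exec.store 2 (.lit 0) (.add counter (.lit 1)) υ'
        rwa [show (Exp.lit 0).eval υ' = 0 from rfl,
          show (Exp.add counter (.lit 1)).eval υ' = j + 1 by
            simp only [Exp.eval, counter, hυ'2, hc]] at this
      have hυ''a : υ'' a = υ' a := Function.update_of_ne ha _ _
      obtain ⟨τ, T, he, hT, hb, hfr', hfill'⟩ := ih (j + 1) (by omega) υ'' (by
          intro b i
          by_cases hb : b = 2
          · subst hb
            by_cases hi : i = 0
            · subst hi; simp only [hυ'', Function.update_self]; omega
            · simpa [hυ'', hi] using hυ'b 2 i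
          · simpa [hυ'', hb] using hυ'b b i)
        (fun c h1 h2 => by simp [hυ'', hυ', h1, h2, hfr c h1 h2])
        (by simp [hυ''])
        (fun i hi => by
          rw [hυ''a]
          rcases Nat.lt_succ_iff_lt_or_eq.1 hi with hi | rfl
          · simpa [hυ', hi.ne] using hfill i hi
          · simp [hυ'])
      refine ⟨τ, _, .loop_step hguard (e1.seq e2) he, ?_, hb, hfr', hfill'⟩
      have t1 := (Exp.sub bound counter).time_le υ hm hυ
      have t2 := body.time_le υ hm hυ
      have s1 : j.size ≤ m := Nat.size_le.2 (by omega)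
      have s2 : (j + 1).size ≤ m := Nat.size_le.2 (by omega)
      have t3 : counter.time υ ≤ m + 4 := by
        simp only [counter, Exp.time, Exp.eval, hc]; simp; omega
      have t4 : (Exp.add counter (.lit 1)).time υ' ≤ 2 * m + 8 := by
        simp only [counter, Exp.time, Exp.eval, hυ'2, hc]; simp; omega
      have t5 : (Exp.lit 0).time υ' = 1 := by simp [Exp.time]
      rw [hweight] at t1
      have h2 := fill_time_aux hm t1 t2
      rw [fillWeight] at hT ⊢
      rw [mul_add _ (k + 1)]
      rw [← mul_assoc] at h2
      rw [mul_one]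
      omega
  set σ' : Mem := Function.update σ 2 (Function.update (σ 2) 0 0) with hσ'
  have e0 : Exec (.store 2 (.lit 0) (.lit 0)) σ σ' 3 := by
    have := Exec.store 2 (.lit 0) (.lit 0) σ
    simpa [Exp.time, Exp.eval] using this
  obtain ⟨τ, T, he, hT, h⟩ := loop B 0 (by omega) σ' (by
      intro b i
      by_cases hb : b = 2
      · subst hb
        by_cases hi : i = 0
        · subst hi; simp [hσ']
        · simpa [hσ', hi] using hσ 2 i
      · simpa [hσ', hb] using hσ b i)
    (fun c _ h2 => by simp [hσ', h2]) (by simp [hσ']) (fun i hi => absurd hi (Nat.not_lt_zero i))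
  refine ⟨τ, _, e0.seq he, ?_, h⟩
  have h3 : 3 ≤ 2 * fillWeight bound body * m := by rw [fillWeight]; nlinarith
  have : 2 * fillWeight bound body * m * (B + 2) =
    2 * fillWeight bound body * m * (B + 1) + 2 * fillWeight bound body * m := by ring
  omega

/-! ### Dynamic programming tables -/

namespace Exp

/-- Minimum, by truncated subtraction. -/
def min (x y : Exp) : Exp := .sub x (.sub x y)

/-- Maximum, by truncated subtraction. -/
def max (x y : Exp) : Exp := .add x (.sub y x)

/-- The indicator of `x ≤ y`. -/
def le (x y : Exp) : Exp := .sub (.lit 1) (.sub x y)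

/-- Remainder. -/
def mod (x y : Exp) : Exp := .sub x (.mul (.div x y) y)

/-- Case distinction on a condition with value `0` or `1`. -/
def cond (c x y : Exp) : Exp := .add (.mul c x) (.mul (.sub (.lit 1) c) y)

variable (σ : Mem) (c x y : Exp)

lemma eval_min : (x.min y).eval σ = Min.min (x.eval σ) (y.eval σ) := by
  simp only [min, eval]; omega

lemma eval_max : (x.max y).eval σ = Max.max (x.eval σ) (y.eval σ) := by
  simp only [max, eval]; omega

lemma eval_le : (x.le y).eval σ = if x.eval σ ≤ y.eval σ then 1 else 0 := by
  simp only [le, eval]; split_ifs <;> omega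

lemma eval_mod : (x.mod y).eval σ = x.eval σ % y.eval σ := by
  simp only [mod, eval]
  have := Nat.div_add_mod (x.eval σ) (y.eval σ)
  rw [mul_comm] at this
  omega

lemma eval_cond (p : Prop) [Decidable p] (hc : c.eval σ = if p then 1 else 0) :
    (cond c x y).eval σ = if p then x.eval σ else y.eval σ := by
  simp only [cond, eval, hc]; split_ifs <;> simp

end Exp

end RAM

/-- The minimum of `init` and `f 0, …, f (w - 1)`. -/
def runMin (init : ℕ) (f : ℕ → ℕ) : ℕ → ℕ
  | 0 => init
  | w + 1 => min (runMin init f w) (f w)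

lemma runMin_le_init (init : ℕ) (f : ℕ → ℕ) (n : ℕ) : runMin init f n ≤ init := by
  induction n with
  | zero => exact le_rfl
  | succ n ih => exact (min_le_left _ _).trans ih

lemma runMin_le {init : ℕ} {f : ℕ → ℕ} {n w : ℕ} (hw : w < n) : runMin init f n ≤ f w := by
  induction n with
  | zero => omega
  | succ n ih =>
    rcases Nat.lt_succ_iff_lt_or_eq.1 hw with h | rfl
    · exact (min_le_left _ _).trans (ih h)
    · exact min_le_right _ _

lemma runMin_eq_or (init : ℕ) (f : ℕ → ℕ) (n : ℕ) :
    runMin init f n = init ∨ ∃ w < n, runMin init f n = f w := by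
  induction n with
  | zero => exact .inl rfl
  | succ n ih =>
    rcases min_choice (runMin init f n) (f n) with h | h
    · rcases ih with ih | ⟨w, hw, ih⟩
      · exact .inl (h.trans ih)
      · exact .inr ⟨w, hw.trans n.lt_succ_self, h.trans ih⟩
    · exact .inr ⟨n, n.lt_succ_self, h⟩

lemma runMin_congr {init : ℕ} {f f' : ℕ → ℕ} {n : ℕ}
    (h : ∀ w < n, f w = f' w ∨ (init ≤ f w ∧ init ≤ f' w)) :
    runMin init f n = runMin init f' n := by
  induction n with
  | zero => rfl
  | succ n ih =>
    have ih := ih fun w hw => h w (hw.trans n.lt_succ_self)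
    have := runMin_le_init init f n
    have := runMin_le_init init f' n
    simp only [runMin]
    rcases h n n.lt_succ_self with h | h <;> omega

/-- `k` rounds of the iteration `x v ← min (init v) (min_w (F v w (x w)))`, started with `0`. -/
def rounds (n : ℕ) (init : ℕ → ℕ) (F : ℕ → ℕ → ℕ → ℕ) : ℕ → ℕ → ℕ
  | 0, _ => 0
  | k + 1, v => runMin (init v) (fun w => F v w (rounds n init F k w)) n

/-- If `F v w` can go below `init v` only where a rank drops, then the iteration is stationary
after as many rounds as there are ranks. -/
lemma rounds_stationary {n : ℕ} {init : ℕ → ℕ} {F : ℕ → ℕ → ℕ → ℕ} (ρ : ℕ → ℕ)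
    (hρ : ∀ v < n, ρ v < n)
    (hF : ∀ v < n, ∀ w < n, ρ w < ρ v ∨ ∀ x, init v ≤ F v w x) {v : ℕ} (hv : v < n) :
    rounds n init F n v = runMin (init v) (fun w => F v w (rounds n init F n w)) n := by
  have key : ∀ k, ∀ v < n, ρ v < k → rounds n init F k v = rounds n init F (k + 1) v := by
    intro k
    induction k with
    | zero => intro v _ h; omega
    | succ k ih =>
      intro v hv hk
      refine runMin_congr fun w hw => ?_
      rcases hF v hv w hw with h | h
      · exact .inl (congrArg _ (ih w hw (by omega)))
      · exact .inr ⟨h _, h _⟩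
  exact key n v hv (hρ v hv)

namespace RAM

/-- The entry of the table of all intermediate results of `rounds`: position
`(k * n + v) * (n + 1) + w` belongs to round `k`, node `v`, and the minimum over the first `w`
values. -/
def tableEntry (n : ℕ) (init : ℕ → ℕ) (F : ℕ → ℕ → ℕ → ℕ) (j : ℕ) : ℕ :=
  runMin (init (j / (n + 1) % n))
    (fun w => F (j / (n + 1) % n) w (rounds n init F (j / (n + 1) / n) w)) (j % (n + 1))

lemma tableEntry_eq {n : ℕ} (init : ℕ → ℕ) (F : ℕ → ℕ → ℕ → ℕ) {k v w : ℕ} (hv : v < n)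
    (hw : w ≤ n) : tableEntry n init F ((k * n + v) * (n + 1) + w) =
      runMin (init v) (fun w => F v w (rounds n init F k w)) w := by
  have h1 : ((k * n + v) * (n + 1) + w) / (n + 1) = k * n + v := by
    rw [mul_comm, Nat.mul_add_div (Nat.succ_pos n), Nat.div_eq_of_lt (by omega), add_zero]
  have h2 : ((k * n + v) * (n + 1) + w) % (n + 1) = w := by
    rw [mul_comm, Nat.mul_add_mod, Nat.mod_eq_of_lt (by omega)]
  have h3 : (k * n + v) / n = k := by
    rw [mul_comm, Nat.mul_add_div (by omega), Nat.div_eq_of_lt hv, add_zero]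
  have h4 : (k * n + v) % n = v := by rw [mul_comm, Nat.mul_add_mod, Nat.mod_eq_of_lt hv]
  rw [tableEntry, h1, h2, h3, h4]

/-- The number of nodes, the first entry of the input. -/
def nE : Exp := .load 0 (.lit 0)

/-- The value for `v` after the last of the `rounds` whose table is in array `a`. -/
def finalE (a : ℕ) (v : Exp) : Exp :=
  .load a (.add (.mul (.add (.mul (.sub nE (.lit 1)) nE) v) (.add nE (.lit 1))) nE)

/-- The expression that computes `tableEntry` from the entries before it. -/
def tableE (a : ℕ) (init : Exp → Exp) (F : Exp → Exp → Exp → Exp) : Exp :=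
  let w := Exp.mod counter (.add nE (.lit 1))
  let r := Exp.div counter (.add nE (.lit 1))
  let v := Exp.mod r nE
  let k := Exp.div r nE
  let w' := Exp.sub w (.lit 1)
  let x := Exp.mul (.le (.lit 1) k)
    (.load a (.add (.mul (.add (.mul (.sub k (.lit 1)) nE) w') (.add nE (.lit 1))) nE))
  .cond (.le w (.lit 0)) (init v) (.min (.load a (.sub counter (.lit 1))) (F v w' x))

lemma eval_finalE {σ : Mem} {a n : ℕ} {init : ℕ → ℕ} {F : ℕ → ℕ → ℕ → ℕ} (hn : σ 0 0 = n)
    (h : ∀ i < n * n * (n + 1), σ a i = tableEntry n init F i) {v : Exp} (hv : v.eval σ < n) :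
    (finalE a v).eval σ = rounds n init F n (v.eval σ) := by
  obtain ⟨k, rfl⟩ : ∃ k, n = k + 1 := ⟨n - 1, by omega⟩
  simp only [finalE, Exp.eval, nE, hn, Nat.add_sub_cancel]
  rw [h _ (by nlinarith), tableEntry_eq _ _ hv le_rfl, rounds]

lemma eval_tableE {τ : Mem} {a n j : ℕ} {init : ℕ → ℕ} {F : ℕ → ℕ → ℕ → ℕ}
    {initE : Exp → Exp} {FE : Exp → Exp → Exp → Exp} (hn : τ 0 0 = n) (hn0 : 0 < n)
    (hj : τ 2 0 = j) (ha : ∀ i < j, τ a i = tableEntry n init F i)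
    (hinit : ∀ v : Exp, v.eval τ < n → (initE v).eval τ = init (v.eval τ))
    (hF : ∀ v w x : Exp, v.eval τ < n → w.eval τ < n →
      (FE v w x).eval τ = F (v.eval τ) (w.eval τ) (x.eval τ)) :
    (tableE a initE FE).eval τ = tableEntry n init F j := by
  obtain ⟨k, v, w, hv, hw, rfl⟩ :
      ∃ k v w, v < n ∧ w ≤ n ∧ j = (k * n + v) * (n + 1) + w := by
    refine ⟨j / (n + 1) / n, j / (n + 1) % n, j % (n + 1), Nat.mod_lt _ hn0,
      Nat.lt_succ_iff.1 (Nat.mod_lt _ (Nat.succ_pos n)), ?_⟩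
    rw [mul_comm _ n, Nat.div_add_mod, mul_comm, Nat.div_add_mod]
  have hnE : nE.eval τ = n := hn
  have hc : counter.eval τ = (k * n + v) * (n + 1) + w := hj
  have h1 : ((k * n + v) * (n + 1) + w) / (n + 1) = k * n + v := by
    rw [mul_comm, Nat.mul_add_div (Nat.succ_pos n), Nat.div_eq_of_lt (by omega), add_zero]
  have h2 : ((k * n + v) * (n + 1) + w) % (n + 1) = w := by
    rw [mul_comm, Nat.mul_add_mod, Nat.mod_eq_of_lt (by omega)]
  have h3 : (k * n + v) / n = k := by
    rw [mul_comm, Nat.mul_add_div (by omega), Nat.div_eq_of_lt hv, add_zero]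
  have h4 : (k * n + v) % n = v := by rw [mul_comm, Nat.mul_add_mod, Nat.mod_eq_of_lt hv]
  rw [tableEntry_eq _ _ hv hw]
  unfold tableE
  extract_lets wE rE vE kE w'E xE
  have hwE : wE.eval τ = w := by simp only [wE, Exp.eval_mod, Exp.eval, hnE, hc, h2]
  have hrE : rE.eval τ = k * n + v := by simp only [rE, Exp.eval, hnE, hc, h1]
  have hvE : vE.eval τ = v := by simp only [vE, Exp.eval_mod, hnE, hrE, h4]
  have hkE : kE.eval τ = k := by simp only [kE, Exp.eval, hnE, hrE, h3]
  have hw'E : w'E.eval τ = w - 1 := by simp only [w'E, Exp.eval, hwE]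
  rw [Exp.eval_cond (p := w ≤ 0) (hc := by rw [Exp.eval_le, hwE]; rfl), Exp.eval_min]
  rcases w with _ | w
  · rw [if_pos le_rfl, hinit _ (by omega), hvE]; rfl
  · rw [if_neg (by omega), hF _ _ _ (by omega) (by omega), hvE, hw'E]
    have hprev : (Exp.load a (.sub counter (.lit 1))).eval τ =
        runMin (init v) (fun w => F v w (rounds n init F k w)) w := by
      simp only [Exp.eval, hc]
      rw [← tableEntry_eq _ _ hv (by omega), ← ha _ (by omega)]
      rfl
    have hx : xE.eval τ = rounds n init F k w := by
      simp only [xE, Exp.eval, Exp.eval_le, hkE, hnE, hw'E, Nat.add_sub_cancel]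
      rcases k with _ | k
      · simp [rounds]
      · rw [if_pos (by omega), one_mul, Nat.add_sub_cancel, ha _ ?_,
          tableEntry_eq _ _ (by omega) le_rfl, rounds]
        have : (k * n + w) + 1 ≤ (k + 1) * n + v := by nlinarith
        nlinarith
    rw [hprev, hx, Nat.add_sub_cancel, runMin]

end RAM

/-! ### Reading the input -/

lemma List.getD_flatMap_of_length_eq {α : Type*} {l : List α} {f : α → List ℕ} {c : ℕ}
    (hf : ∀ a, (f a).length = c) {i j : ℕ} (hi : i < l.length) (hj : j < c) :
    (l.flatMap f).getD (c * i + j) 0 = (f l[i]).getD j 0 := by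
  induction l generalizing i with
  | nil => simp at hi
  | cons a l ih =>
    rw [List.flatMap_cons]
    rcases i with _ | i
    · rw [List.getD_append _ _ _ _ (by rw [hf]; omega)]; simp
    · have hle : c ≤ c * (i + 1) + j := by nlinarith
      rw [List.getD_append_right _ _ _ _ (by rw [hf]; exact hle), hf,
        show c * (i + 1) + j - c = c * i + j by rw [mul_add]; omega]
      simpa using ih (by simpa using hi)

lemma List.length_flatMap_of_length_eq {α : Type*} (l : List α) {f : α → List ℕ} {c : ℕ}
    (hf : ∀ a, (f a).length = c) : (l.flatMap f).length = c * l.length := by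
  simp [List.length_flatMap, hf, mul_comm]

namespace UPBInstance

variable (I : UPBInstance)

/-- The `i`-th entry of the input. -/
def inp (i : ℕ) : ℕ := I.encode.getD i 0

/-- The position of the cost matrix in the input. -/
def base : ℕ := 4 + 4 * I.intervals.length

lemma length_encodeEntry (x : Option ℚ≥0) : (encodeEntry x).length = 2 := by
  cases x <;> rfl

lemma length_encode : I.encode.length = I.base + 2 * (I.n * I.n) := by
  rw [encode, List.length_append, List.length_append,
    List.length_flatMap_of_length_eq (c := 4) _ fun _ => rfl,
    List.length_flatMap_of_length_eq (c := 2 * I.n) _ fun u => by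
      rw [List.length_flatMap_of_length_eq (c := 2) _ fun v => length_encodeEntry _,
        List.length_finRange],
    List.length_finRange, base]
  simp only [List.length_cons, List.length_nil]
  ring

lemma inp_interval {i j : ℕ} (hi : i < I.intervals.length) (hj : j < 4) :
    I.inp (4 + 4 * i + j) =
      [(I.intervals[i]).1.num, (I.intervals[i]).1.den, (I.intervals[i]).2.num,
        (I.intervals[i]).2.den].getD j 0 := by
  rw [inp, encode, List.getD_append _ _ _ _ ?_, List.getD_append_right _ _ _ _ ?_,
    ← List.getD_flatMap_of_length_eq (l := I.intervals) (c := 4)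
      (f := fun p => [p.1.num, p.1.den, p.2.num, p.2.den]) (fun _ => rfl) hi hj]
  · congr 1; simp only [List.length_cons, List.length_nil]; omega
  · simp only [List.length_cons, List.length_nil]; omega
  · rw [List.length_append, List.length_flatMap_of_length_eq (c := 4) _ fun _ => rfl]
    simp only [List.length_cons, List.length_nil]; omega

lemma inp_cost (u v : Fin I.n) {j : ℕ} (hj : j < 2) :
    I.inp (I.base + 2 * (u * I.n + v) + j) = (encodeEntry (I.cost u v)).getD j 0 := by
  have hlen : ∀ u : Fin I.n, ((List.finRange I.n).flatMap
      (fun v => encodeEntry (I.cost u v))).length = 2 * I.n := fun u => by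
    rw [List.length_flatMap_of_length_eq (c := 2) _ fun v => length_encodeEntry _,
        List.length_finRange]
  have hv := v.2
  have h1 := List.getD_flatMap_of_length_eq (l := List.finRange I.n) (i := u)
    (j := 2 * v + j) hlen (by simp) (by omega)
  have h2 := List.getD_flatMap_of_length_eq (l := List.finRange I.n) (i := v)
    (f := fun v => encodeEntry (I.cost u v)) (j := j) (fun v => length_encodeEntry _)
    (by simp) hj
  simp only [List.getElem_finRange, Fin.cast_mk, Fin.eta] at h1 h2
  rw [inp, encode, List.getD_append_right _ _ _ _ ?_, ← h2, ← h1]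
  · congr 1
    rw [List.length_append, List.length_flatMap_of_length_eq (c := 4) _ fun _ => rfl, base]
    simp only [List.length_cons, List.length_nil]
    have : 2 * (u * I.n + v) = 2 * I.n * u + 2 * (v : ℕ) := by ring
    omega
  · rw [List.length_append, List.length_flatMap_of_length_eq (c := 4) _ fun _ => rfl, base]
    simp only [List.length_cons, List.length_nil]; omega

lemma inp_lt (i : ℕ) : I.inp i < 2 ^ RAM.inputSize I.encode := by
  rw [inp, RAM.inputSize]
  generalize I.encode = l
  induction l generalizing i with
  | nil => simp
  | cons a l ih =>
    rw [List.map_cons, List.sum_cons]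
    rcases i with _ | i
    · refine (Nat.lt_size_self a).trans_le (Nat.pow_le_pow_right two_pos ?_)
      omega
    · exact (ih i).trans_le (Nat.pow_le_pow_right two_pos (Nat.le_add_left _ _))

lemma length_encode_le : I.encode.length ≤ RAM.inputSize I.encode := by
  rw [RAM.inputSize]
  generalize I.encode = l
  induction l with
  | nil => simp
  | cons a l ih => rw [List.map_cons, List.sum_cons, List.length_cons]; omega

/-! ### The scaled costs -/

/-- The product of the non-zero numbers among the first `j` entries of the input. -/
def prods (j : ℕ) : ℕ := ∏ i ∈ Finset.range j, max 1 (I.inp i)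

/-- The product of all non-zero numbers in the input. It is a common denominator of the data, and
a bound on each of its numbers. -/
def scale : ℕ := I.prods (I.base + 2 * (I.n * I.n))

lemma prods_le {j : ℕ} (hj : j ≤ I.base + 2 * (I.n * I.n)) : I.prods j ≤ I.scale :=
  Finset.prod_le_prod_of_subset_of_one_le' (Finset.range_subset_range.2 hj)
    fun _ _ _ => le_max_left _ _

lemma scale_le : I.scale ≤ 2 ^ RAM.inputSize I.encode := by
  rw [scale, ← length_encode, RAM.inputSize, prods]
  unfold inp
  generalize I.encode = l
  induction l with
  | nil => simp
  | cons a l ih =>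
    rw [List.length_cons, Finset.prod_range_succ', List.map_cons, List.sum_cons, pow_add, mul_comm]
    refine Nat.mul_le_mul (max_le Nat.one_le_two_pow ?_) (by simpa using ih)
    exact (Nat.lt_size_self a).le.trans (Nat.pow_le_pow_right two_pos (Nat.le_succ _))

lemma scale_pos : 0 < I.scale := by
  unfold scale prods
  exact Finset.prod_pos fun _ _ => lt_of_lt_of_le one_pos (le_max_left _ _)

lemma dvd_scale {i : ℕ} (hi : i < I.base + 2 * (I.n * I.n)) (h : I.inp i ≠ 0) :
    I.inp i ∣ I.scale := by
  have := Finset.dvd_prod_of_mem (fun i => max 1 (I.inp i)) (Finset.mem_range.2 hi)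
  rwa [max_eq_right (Nat.one_le_iff_ne_zero.2 h)] at this

lemma inp_le_scale {i : ℕ} (hi : i < I.base + 2 * (I.n * I.n)) : I.inp i ≤ I.scale := by
  rcases eq_or_ne (I.inp i) 0 with h | h
  · rw [h]; exact Nat.zero_le _
  · exact Nat.le_of_dvd I.scale_pos (I.dvd_scale hi h)

/-- The minima of left end points of intervals, scaled. The scale itself serves as initial value
since no present bias exceeds `1`. -/
def biasMin (i : ℕ) : ℕ :=
  runMin I.scale (fun i => I.inp (4 + 4 * i) * I.scale / I.inp (4 + 4 * i + 1)) i

/-- The scaled minimum of the present bias set. -/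
def bias : ℕ := I.biasMin I.intervals.length

/-- A number exceeding the scaled cost of each path. -/
def infinity : ℕ := (I.scale + 1) * (I.scale + 1) * (I.scale + 1)

/-- The scaled cost matrix in row-major order, with entry `infinity` where there is no edge. -/
def costEntry (j : ℕ) : ℕ :=
  if I.inp (I.base + 2 * j + 1) ≤ 0 then I.infinity
  else I.inp (I.base + 2 * j) * I.scale / I.inp (I.base + 2 * j + 1)

/-- The scaled costs. -/
def cst (v w : ℕ) : ℕ := I.costEntry (v * I.n + w)

lemma mul_div_cast {p q N : ℕ} {x : ℚ≥0} (hp : x.num = p) (hq : x.den = q) (h : q ∣ N) :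
    ((p * N / q : ℕ) : ℝ) = N * (x : ℝ) := by
  obtain ⟨k, rfl⟩ := h
  have hq0 : 0 < q := hq ▸ x.den_pos
  have hx : x = (p : ℚ≥0) / q := by rw [← hp, ← hq, NNRat.num_div_den]
  rw [show p * (q * k) = q * (p * k) by ring, Nat.mul_div_cancel_left _ hq0, hx]
  have : (q : ℝ) ≠ 0 := by exact_mod_cast hq0.ne'
  push_cast
  field_simp

lemma scaled_left_endpoint {i : ℕ} (hi : i < I.intervals.length) :
    ((I.inp (4 + 4 * i) * I.scale / I.inp (4 + 4 * i + 1) : ℕ) : ℝ) =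
      I.scale * ((I.intervals[i]).1 : ℝ) := by
  have h0 : I.inp (4 + 4 * i) = (I.intervals[i]).1.num := I.inp_interval hi (j := 0) (by omega)
  have h1 : I.inp (4 + 4 * i + 1) = (I.intervals[i]).1.den := I.inp_interval hi (by omega)
  refine mul_div_cast h0.symm h1.symm (I.dvd_scale (by rw [base]; omega) ?_)
  rw [h1]; exact NNRat.den_ne_zero _

lemma cst_of_none {u v : Fin I.n} (h : I.cost u v = none) : I.cst u v = I.infinity := by
  have := I.inp_cost u v (j := 1) (by omega)
  rw [h] at this
  rw [cst, costEntry, this]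
  rfl

lemma cost_position_lt (u v : Fin I.n) {j : ℕ} (hj : j < 2) :
    I.base + 2 * (u * I.n + v) + j < I.base + 2 * (I.n * I.n) := by
  have hu := u.2
  have hv := v.2
  have : (u + 1 : ℕ) * I.n ≤ I.n * I.n := Nat.mul_le_mul_right _ hu
  rw [add_mul] at this
  omega

lemma cst_of_some {u v : Fin I.n} {q : ℚ≥0} (h : I.cost u v = some q) :
    (I.cst u v : ℝ) = I.scale * (q : ℝ) := by
  have h0 : I.inp (I.base + 2 * (u * I.n + v)) = q.num :=
    (I.inp_cost u v (j := 0) (by omega)).trans (by rw [h]; rfl)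
  have h1 : I.inp (I.base + 2 * (u * I.n + v) + 1) = q.den := by
    rw [I.inp_cost u v (by omega), h]; rfl
  have h2 : I.inp (I.base + 2 * (u * I.n + v) + 1) ≠ 0 := h1 ▸ NNRat.den_ne_zero _
  rw [cst, costEntry, if_neg (by omega)]
  exact mul_div_cast h0.symm h1.symm (I.dvd_scale (I.cost_position_lt u v (by omega)) h2)

lemma cst_le_of_isSome {u v : Fin I.n} (h : (I.cost u v).isSome) :
    I.cst u v ≤ I.scale * I.scale := by
  obtain ⟨q, hq⟩ := Option.isSome_iff_exists.1 h
  have h1 : I.inp (I.base + 2 * (u * I.n + v) + 1) = q.den := by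
    rw [I.inp_cost u v (by omega), hq]; rfl
  have := q.den_pos
  rw [cst, costEntry, if_neg (by omega)]
  exact (Nat.div_le_self _ _).trans
    (Nat.mul_le_mul_right _ (I.inp_le_scale (I.cost_position_lt u v (j := 0) (by omega))))

lemma n_le_scale : I.n ≤ I.scale := I.inp_le_scale (i := 0) (by rw [base]; omega)

lemma bias_le_scale : I.bias ≤ I.scale := runMin_le_init _ _ _

lemma bias_le {p : ℚ≥0 × ℚ≥0} (hp : p ∈ I.intervals) :
    (I.bias : ℝ) ≤ I.scale * (p.1 : ℝ) := by
  obtain ⟨i, hi, rfl⟩ := List.getElem_of_mem hp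
  rw [← I.scaled_left_endpoint hi]
  exact_mod_cast runMin_le hi

lemma exists_bias_eq : ∃ p ∈ I.intervals, (I.bias : ℝ) = I.scale * (p.1 : ℝ) := by
  rcases runMin_eq_or I.scale
    (fun i => I.inp (4 + 4 * i) * I.scale / I.inp (4 + 4 * i + 1)) I.intervals.length
    with h | ⟨i, hi, h⟩
  · -- All left end points are equal to `1`.
    obtain ⟨p, hp⟩ := List.exists_mem_of_ne_nil _ I.intervals_ne_nil
    refine ⟨p, hp, le_antisymm (I.bias_le hp) ?_⟩
    have hp1 : (p.1 : ℝ) ≤ 1 := by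
      exact_mod_cast (I.intervals_valid p hp).2.1.trans (I.intervals_valid p hp).2.2
    rw [show I.bias = I.scale from h]
    exact mul_le_of_le_one_right (Nat.cast_nonneg _) hp1
  · exact ⟨_, List.getElem_mem hi, by rw [← I.scaled_left_endpoint hi]; exact_mod_cast h⟩

lemma bias_pos : 0 < I.bias := by
  obtain ⟨p, hp, h⟩ := I.exists_bias_eq
  have h1 : (0 : ℝ) < p.1 := by exact_mod_cast (I.intervals_valid p hp).1
  have h2 : (0 : ℝ) < I.scale := by exact_mod_cast I.scale_pos
  have : (0 : ℝ) < I.bias := h ▸ mul_pos h2 h1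
  exact_mod_cast this

end UPBInstance

namespace UPBInstance

variable (I : UPBInstance)

/-! ### Distances, bottlenecks and charges in integers -/

/-- The distances to `t`, scaled. -/
def dst : ℕ → ℕ :=
  rounds I.n (fun v => if v = (I.t : ℕ) then 0 else I.infinity) (fun v w x => I.cst v w + x) I.n

/-- The value `c(v, w) / b + d(w)` of an edge, scaled by `scale * bias`. -/
def edgeVal (v w : ℕ) : ℕ := I.cst v w * I.scale + I.dst w * I.bias

/-- The minmax values of the paths to `t` with respect to `edgeVal`. -/
def bottleneck : ℕ → ℕ :=
  rounds I.n (fun v => if v = (I.t : ℕ) then 0 else I.infinity * I.scale)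
    (fun v w x => max (I.edgeVal v w) x) I.n

/-- The minmax value at `s`, which is half of the reward to be output. -/
def opt : ℕ := I.bottleneck I.s

/-- Edges of paths to `t` along which the agent can be motivated by half of the reward if
nothing is charged. -/
def Good (v w : ℕ) : Prop := I.bottleneck w ≤ I.opt ∧ I.edgeVal v w ≤ I.opt

/-- First edges of cheapest paths to `t`. -/
def Tight (v w : ℕ) : Prop := I.cst v w + I.dst w ≤ I.dst v

instance (v w : ℕ) : Decidable (I.Good v w) := inferInstanceAs (Decidable (_ ∧ _))
instance (v w : ℕ) : Decidable (I.Tight v w) := inferInstanceAs (Decidable (_ ≤ _))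

/-- Edges that are not charged: the good edges, and the tight ones that leave nodes of greater
bottleneck than `s`. -/
def Free (v w : ℕ) : Prop := I.Good v w ∨ (¬ I.bottleneck v ≤ I.opt ∧ I.Tight v w)

instance (v w : ℕ) : Decidable (I.Free v w) := inferInstanceAs (Decidable (_ ∨ _))

/-- The distances to `t` after charging, scaled: the recursion runs over free edges, and a path
of cost `2 * dst v` is available in any case. -/
def newDst : ℕ → ℕ :=
  rounds I.n (fun v => 2 * I.dst v)
    (fun v w x => I.cst v w + x + if I.Free v w then 0 else 2 * I.dst v) I.n

/-- The scaled cost configuration. Tight edges that are not free are charged such that they lead to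
`t` at the cost `2 * dst v`. Edges which are neither free nor tight are blocked by a charge that
exceeds both the reward and the distance to `t`. -/
def charge (v w : ℕ) : ℕ :=
  if I.Free v w then 0
  else if I.Tight v w then 2 * I.dst v - (I.cst v w + I.newDst w)
  else 2 * I.dst v + 2 * I.opt + 1

/-- The edge relation on the node numbers. -/
def IsEdge (v w : ℕ) : Prop := ∃ (hv : v < I.n) (hw : w < I.n), (I.cost ⟨v, hv⟩ ⟨w, hw⟩).isSome

lemma exists_rank : ∃ ρ : ℕ → ℕ, (∀ v < I.n, ρ v < I.n) ∧
    ∀ v w, I.IsEdge v w → ρ w < ρ v := by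
  obtain ⟨ρ, h1, h2⟩ := exists_rank_lt_of_acyclic I.acyclic
  refine ⟨fun v => if h : v < I.n then ρ ⟨v, h⟩ else 0, fun v hv => ?_, ?_⟩
  · simpa [hv] using h2 ⟨v, hv⟩
  · rintro v w ⟨hv, hw, h⟩
    simpa [hv, hw] using h1 _ _ h

lemma cst_of_not_isEdge {v w : ℕ} (hv : v < I.n) (hw : w < I.n) (h : ¬ I.IsEdge v w) :
    I.cst v w = I.infinity := by
  refine I.cst_of_none (u := ⟨v, hv⟩) (v := ⟨w, hw⟩) ?_
  rw [← Option.not_isSome_iff_eq_none]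
  exact fun h' => h ⟨hv, hw, h'⟩

lemma cst_le_of_isEdge {v w : ℕ} (h : I.IsEdge v w) : I.cst v w ≤ I.scale * I.scale := by
  obtain ⟨hv, hw, h⟩ := h
  exact I.cst_le_of_isSome (u := ⟨v, hv⟩) (v := ⟨w, hw⟩) h

lemma exists_isEdge {v : ℕ} (hv : v < I.n) (ht : v ≠ I.t) : ∃ w, I.IsEdge v w := by
  obtain ⟨w, hw⟩ := I.graph.exists_adj (v := ⟨v, hv⟩) fun h => ht (congrArg Fin.val h)
  exact ⟨w, hv, w.2, hw⟩

lemma isEdge_lt {v w : ℕ} (h : I.IsEdge v w) : v < I.n ∧ w < I.n := ⟨h.1, h.2.1⟩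

/-- A recursion over the edges in which the values of other pairs do not matter has a solution
after `n` rounds, since the graph is acyclic. -/
lemma rounds_eq {init : ℕ → ℕ} {F : ℕ → ℕ → ℕ → ℕ}
    (hF : ∀ v < I.n, ∀ w < I.n, ¬ I.IsEdge v w → ∀ x, init v ≤ F v w x) {v : ℕ} (hv : v < I.n) :
    rounds I.n init F I.n v = runMin (init v) (fun w => F v w (rounds I.n init F I.n w)) I.n := by
  obtain ⟨ρ, h1, h2⟩ := I.exists_rank
  refine rounds_stationary ρ h1 (fun v hv w hw => ?_) hv
  by_cases h : I.IsEdge v w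
  · exact .inl (h2 v w h)
  · exact .inr (hF v hv w hw h)

lemma dst_eq {v : ℕ} (hv : v < I.n) : I.dst v =
    runMin (if v = (I.t : ℕ) then 0 else I.infinity) (fun w => I.cst v w + I.dst w) I.n := by
  refine I.rounds_eq (fun v hv w hw h x => ?_) hv
  rw [I.cst_of_not_isEdge hv hw h]
  split_ifs <;> omega

lemma dst_t : I.dst I.t = 0 := by
  have := (I.dst_eq I.t.2).trans_le (runMin_le_init _ _ _)
  simpa using this

lemma dst_le {v w : ℕ} (hv : v < I.n) (hw : w < I.n) : I.dst v ≤ I.cst v w + I.dst w :=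
  (I.dst_eq hv).trans_le (runMin_le hw)

lemma cst_add_dst_lt {v w : ℕ} (h : I.IsEdge v w) : I.cst v w + I.dst w < I.infinity := by
  obtain ⟨ρ, h1, h2⟩ := I.exists_rank
  have key : ∀ k, ∀ v < I.n, ρ v = k → I.dst v ≤ k * (I.scale * I.scale) := by
    intro k
    induction k using Nat.strong_induction_on with
    | _ k ih =>
      intro v hv hk
      by_cases hvt : v = I.t
      · rw [hvt, I.dst_t]; exact Nat.zero_le _
      obtain ⟨w, hw⟩ := I.exists_isEdge hv hvt
      have hr := hk ▸ h2 v w hw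
      have h3 := ih _ hr w (I.isEdge_lt hw).2 rfl
      have h4 := I.dst_le hv (I.isEdge_lt hw).2
      have h5 := I.cst_le_of_isEdge hw
      have h6 : (ρ w + 1) * (I.scale * I.scale) ≤ k * (I.scale * I.scale) :=
        Nat.mul_le_mul_right _ hr
      rw [add_mul] at h6
      omega
  have h3 := key _ w (I.isEdge_lt h).2 rfl
  have h4 := h1 w (I.isEdge_lt h).2
  have h5 := I.cst_le_of_isEdge h
  have h6 := I.n_le_scale
  have h7 : (ρ w + 1) * (I.scale * I.scale) ≤ I.scale * (I.scale * I.scale) :=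
    Nat.mul_le_mul_right _ (by omega)
  rw [infinity]
  nlinarith [Nat.zero_le I.scale]

lemma infinity_pos : 0 < I.infinity := by rw [infinity]; positivity

lemma dst_lt {v : ℕ} (hv : v < I.n) : I.dst v < I.infinity := by
  by_cases hvt : v = I.t
  · rw [hvt, I.dst_t]; exact I.infinity_pos
  obtain ⟨w, hw⟩ := I.exists_isEdge hv hvt
  exact (I.dst_le hv (I.isEdge_lt hw).2).trans_lt (I.cst_add_dst_lt hw)

lemma isEdge_of_tight {v w : ℕ} (hv : v < I.n) (hw : w < I.n) (h : I.Tight v w) :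
    I.IsEdge v w := by
  by_contra hne
  have h1 := I.dst_lt hv
  have h2 := I.cst_of_not_isEdge hv hw hne
  unfold Tight at h
  omega

lemma exists_tight {v : ℕ} (hv : v < I.n) (hvt : v ≠ I.t) : ∃ w, I.IsEdge v w ∧ I.Tight v w := by
  rcases runMin_eq_or (if v = (I.t : ℕ) then 0 else I.infinity)
    (fun w => I.cst v w + I.dst w) I.n with h | ⟨w, hw, h⟩ <;> rw [← I.dst_eq hv] at h
  · rw [if_neg hvt] at h
    exact absurd h (I.dst_lt hv).ne
  · exact ⟨w, I.isEdge_of_tight hv hw h.ge, h.ge⟩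

lemma edgeVal_lt {v w : ℕ} (h : I.IsEdge v w) : I.edgeVal v w < I.infinity * I.scale := by
  have h1 := Nat.mul_lt_mul_of_pos_right (I.cst_add_dst_lt h) I.scale_pos
  have h2 : I.dst w * I.bias ≤ I.dst w * I.scale := Nat.mul_le_mul_left _ I.bias_le_scale
  rw [add_mul] at h1
  rw [edgeVal]
  omega

lemma le_edgeVal {v w : ℕ} (hv : v < I.n) (hw : w < I.n) (h : ¬ I.IsEdge v w) :
    I.infinity * I.scale ≤ I.edgeVal v w := by
  rw [edgeVal, I.cst_of_not_isEdge hv hw h]; exact Nat.le_add_right _ _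

lemma bottleneck_eq {v : ℕ} (hv : v < I.n) : I.bottleneck v =
    runMin (if v = (I.t : ℕ) then 0 else I.infinity * I.scale)
      (fun w => max (I.edgeVal v w) (I.bottleneck w)) I.n := by
  refine I.rounds_eq (fun v hv w hw h x => le_trans ?_ (le_max_left _ _)) hv
  have := I.le_edgeVal hv hw h
  split_ifs <;> omega

lemma bottleneck_t : I.bottleneck I.t = 0 := by
  have := (I.bottleneck_eq I.t.2).trans_le (runMin_le_init _ _ _)
  simpa using this

lemma bottleneck_le {v w : ℕ} (hv : v < I.n) (hw : w < I.n) :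
    I.bottleneck v ≤ max (I.edgeVal v w) (I.bottleneck w) :=
  (I.bottleneck_eq hv).trans_le (runMin_le hw)

lemma bottleneck_lt {v : ℕ} (hv : v < I.n) : I.bottleneck v < I.infinity * I.scale := by
  obtain ⟨ρ, h1, h2⟩ := I.exists_rank
  induction hk : ρ v using Nat.strong_induction_on generalizing v with
  | _ k ih =>
    by_cases hvt : v = I.t
    · rw [hvt, I.bottleneck_t]; exact Nat.mul_pos I.infinity_pos I.scale_pos
    obtain ⟨w, hw⟩ := I.exists_isEdge hv hvt
    exact (I.bottleneck_le hv (I.isEdge_lt hw).2).trans_lt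
      (max_lt (I.edgeVal_lt hw) (ih _ (hk ▸ h2 v w hw) (I.isEdge_lt hw).2 rfl))

lemma opt_lt : I.opt < I.infinity * I.scale := I.bottleneck_lt I.s.2

lemma isEdge_of_good {v w : ℕ} (hv : v < I.n) (hw : w < I.n) (h : I.Good v w) :
    I.IsEdge v w := by
  by_contra hne
  have := I.le_edgeVal hv hw hne
  have := I.opt_lt
  have := h.2
  omega

lemma bottleneck_le_of_good {v w : ℕ} (hv : v < I.n) (hw : w < I.n) (h : I.Good v w) :
    I.bottleneck v ≤ I.opt := (I.bottleneck_le hv hw).trans (max_le h.2 h.1)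

lemma exists_good {v : ℕ} (hv : v < I.n) (hvt : v ≠ I.t) (h : I.bottleneck v ≤ I.opt) :
    ∃ w, I.IsEdge v w ∧ I.Good v w := by
  rcases runMin_eq_or (if v = (I.t : ℕ) then 0 else I.infinity * I.scale)
    (fun w => max (I.edgeVal v w) (I.bottleneck w)) I.n with h' | ⟨w, hw, h'⟩ <;>
    rw [← I.bottleneck_eq hv] at h'
  · rw [if_neg hvt] at h'
    exact absurd h' (I.bottleneck_lt hv).ne
  · have hg : I.Good v w :=
      ⟨(le_max_right _ _).trans (h'.ge.trans h), (le_max_left _ _).trans (h'.ge.trans h)⟩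
    exact ⟨w, I.isEdge_of_good hv hw hg, hg⟩

lemma isEdge_of_free {v w : ℕ} (hv : v < I.n) (hw : w < I.n) (h : I.Free v w) :
    I.IsEdge v w :=
  h.elim (I.isEdge_of_good hv hw) fun h => I.isEdge_of_tight hv hw h.2

lemma newDst_eq {v : ℕ} (hv : v < I.n) : I.newDst v =
    runMin (2 * I.dst v)
      (fun w => I.cst v w + I.newDst w + if I.Free v w then 0 else 2 * I.dst v) I.n := by
  refine I.rounds_eq (fun v hv w hw h x => ?_) hv
  rw [if_neg fun h' => h (I.isEdge_of_free hv hw h')]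
  exact Nat.le_add_left _ _

lemma newDst_le_two_mul {v : ℕ} (hv : v < I.n) : I.newDst v ≤ 2 * I.dst v :=
  (I.newDst_eq hv).trans_le (runMin_le_init _ _ _)

lemma charge_of_free {v w : ℕ} (h : I.Free v w) : I.charge v w = 0 := if_pos h

lemma newDst_le_of_free {v w : ℕ} (hv : v < I.n) (hw : w < I.n) (h : I.Free v w) :
    I.newDst v ≤ I.cst v w + I.newDst w := by
  have := (I.newDst_eq hv).trans_le (runMin_le hw)
  rwa [if_pos h, add_zero] at this

/-- A charged tight edge leads to `t` at the cost `2 * dst v`. -/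
lemma cst_add_charge_of_tight {v w : ℕ} (hw : w < I.n) (h : ¬ I.Free v w) (ht : I.Tight v w) :
    I.cst v w + I.charge v w + I.newDst w = 2 * I.dst v := by
  have h1 := I.newDst_le_two_mul hw
  rw [charge, if_neg h, if_pos ht]
  unfold Tight at ht
  omega

lemma charge_of_not_tight {v w : ℕ} (h : ¬ I.Free v w) (ht : ¬ I.Tight v w) :
    I.charge v w = 2 * I.dst v + 2 * I.opt + 1 := by rw [charge, if_neg h, if_neg ht]

lemma newDst_le {v w : ℕ} (hv : v < I.n) (hw : w < I.n) :
    I.newDst v ≤ I.cst v w + I.charge v w + I.newDst w := by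
  by_cases hf : I.Free v w
  · rw [I.charge_of_free hf]; exact I.newDst_le_of_free hv hw hf
  · have h1 := I.newDst_le_two_mul hv
    by_cases ht : I.Tight v w
    · rw [I.cst_add_charge_of_tight hw hf ht]; exact h1
    · rw [I.charge_of_not_tight hf ht]; omega

lemma exists_newDst_eq {v : ℕ} (hv : v < I.n) (hvt : v ≠ I.t) :
    ∃ w, I.IsEdge v w ∧ I.newDst v = I.cst v w + I.charge v w + I.newDst w := by
  rcases runMin_eq_or (2 * I.dst v)
    (fun w => I.cst v w + I.newDst w + if I.Free v w then 0 else 2 * I.dst v) I.n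
    with h | ⟨w, hw, h⟩ <;> rw [← I.newDst_eq hv] at h
  · obtain ⟨w, hw, ht⟩ := I.exists_tight hv hvt
    refine ⟨w, hw, le_antisymm (I.newDst_le hv (I.isEdge_lt hw).2) ?_⟩
    have h1 := I.newDst_le_two_mul (I.isEdge_lt hw).2
    by_cases hf : I.Free v w
    · rw [I.charge_of_free hf]
      unfold Tight at ht
      omega
    · rw [I.cst_add_charge_of_tight (I.isEdge_lt hw).2 hf ht, h]
  · by_cases hf : I.Free v w
    · refine ⟨w, I.isEdge_of_free hv hw hf, ?_⟩
      rw [I.charge_of_free hf]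
      simpa [hf] using h
    · -- The value of a pair that is not free is attained only if it equals `2 * dst v`.
      obtain ⟨u, hu, ht⟩ := I.exists_tight hv hvt
      refine ⟨u, hu, le_antisymm (I.newDst_le hv (I.isEdge_lt hu).2) ?_⟩
      have h0 := I.newDst_le_two_mul hv
      rw [if_neg hf] at h
      have h1 := I.newDst_le_two_mul (I.isEdge_lt hu).2
      by_cases hf' : I.Free v u
      · rw [I.charge_of_free hf']
        unfold Tight at ht
        omega
      · rw [I.cst_add_charge_of_tight (I.isEdge_lt hu).2 hf' ht]
        omega

/-! ### The quality of the output -/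

lemma graph_cost_eq {u v : Fin I.n} (h : I.graph.Adj u v) :
    (I.graph.cost u v : ℝ) = (I.cst u v : ℝ) / I.scale := by
  obtain ⟨q, hq⟩ := Option.isSome_iff_exists.1 h
  have hN : (I.scale : ℝ) ≠ 0 := by exact_mod_cast I.scale_pos.ne'
  rw [I.cst_of_some hq, mul_div_cancel_left₀ _ hN]
  simp only [graph, hq, Option.getD_some]
  rfl

lemma dist_eq (v : Fin I.n) : I.graph.dist v = (I.dst v : ℝ) / I.scale := by
  refine I.graph.dist_eq_of_bellman (fun v => (I.dst v : ℝ) / I.scale) ?_ ?_ ?_ v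
  · have : I.dst (I.graph.t : ℕ) = 0 := I.dst_t
    simp [this]
  · intro v w h
    rw [I.graph_cost_eq h, ← add_div]
    gcongr
    exact_mod_cast I.dst_le v.2 w.2
  · intro v hv
    obtain ⟨w, hw, ht⟩ := I.exists_tight v.2 fun h => hv (Fin.ext h)
    obtain ⟨hv', hw', h⟩ := id hw
    have hadj : I.graph.Adj v ⟨w, hw'⟩ := h
    refine ⟨⟨w, hw'⟩, hadj, ?_⟩
    rw [I.graph_cost_eq hadj, ← add_div]
    congr 1
    exact_mod_cast le_antisymm (I.dst_le v.2 hw') ht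

/-- The reward computed. -/
def reward : ℚ≥0 := ((2 * I.opt : ℕ) : ℚ≥0) / ((I.bias * I.scale : ℕ) : ℚ≥0)

/-- The cost configuration computed, over the same denominator as the reward. -/
def config (u v : Fin I.n) : ℚ≥0 :=
  ((I.charge u v * I.bias : ℕ) : ℚ≥0) / ((I.bias * I.scale : ℕ) : ℚ≥0)

lemma config_eq (u v : Fin I.n) :
    (((I.config u v : ℚ≥0) : ℝ≥0) : ℝ) = (I.charge u v : ℝ) / I.scale := by
  have h1 : (I.bias : ℝ) ≠ 0 := by exact_mod_cast I.bias_pos.ne'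
  have h2 : (I.scale : ℝ) ≠ 0 := by exact_mod_cast I.scale_pos.ne'
  rw [config]
  push_cast
  field_simp

lemma reward_eq : (I.reward : ℝ) = 2 * ((I.opt : ℝ) / (I.bias * I.scale)) := by
  rw [reward]; push_cast; ring

lemma edgeVal_le_iff {u v : Fin I.n} (h : I.graph.Adj u v) {q : ℕ} :
    I.edgeVal u v ≤ q ↔ I.graph.cost u v + (I.bias / I.scale : ℝ) * (I.dst v / I.scale) ≤
      (I.bias / I.scale : ℝ) * (q / (I.bias * I.scale)) := by
  have h1 : (0 : ℝ) < I.bias := by exact_mod_cast I.bias_pos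
  have h2 : (0 : ℝ) < I.scale := by exact_mod_cast I.scale_pos
  have e1 : (I.graph.cost u v : ℝ) + (I.bias / I.scale : ℝ) * (I.dst v / I.scale) =
      (I.edgeVal u v : ℝ) / (I.scale * I.scale) := by
    rw [I.graph_cost_eq h, edgeVal]; push_cast; field_simp
  have e2 : (I.bias / I.scale : ℝ) * (q / (I.bias * I.scale)) = q / (I.scale * I.scale) := by
    field_simp
  rw [e1, e2, div_le_div_iff_of_pos_right (by positivity)]
  exact_mod_cast Iff.rfl

lemma motivatingForAll_config : I.graph.MotivatingForAll I.biasSet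
    (fun u v => ((I.config u v : ℚ≥0) : ℝ≥0)) (I.reward : ℝ) := by
  rintro β ⟨p, hp, hpβ, hβp⟩
  have hbias : (0 : ℝ) < I.bias := by exact_mod_cast I.bias_pos
  have hN : (0 : ℝ) < I.scale := by exact_mod_cast I.scale_pos
  have hβ1 : β ≤ 1 := hβp.trans (by exact_mod_cast (I.intervals_valid p hp).2.2)
  have hbβ : (I.bias / I.scale : ℝ) ≤ β := by
    rw [div_le_iff₀ hN, mul_comm]
    exact (I.bias_le hp).trans (mul_le_mul_of_nonneg_left hpβ hN.le)
  have hvt : ∀ v : Fin I.n, v ≠ I.graph.t → (v : ℕ) ≠ I.t := fun v h h' => h (Fin.ext h')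
  rw [reward_eq]
  refine I.graph.motivating_of_potential _ (fun v => I.bottleneck v ≤ I.opt)
    (fun v => (I.dst v : ℝ) / I.scale) (fun v => (I.newDst v : ℝ) / I.scale)
    (b := I.bias / I.scale) (by positivity) hbβ hβ1 (fun v => by positivity) ?_ ?_ le_rfl ?_ ?_ ?_ ?_
  · have h1 := I.newDst_le_two_mul I.t.2
    rw [I.dst_t, mul_zero] at h1
    have : I.newDst (I.graph.t : ℕ) = 0 := Nat.le_zero.1 h1
    simp [this]
  · intro v
    rw [← mul_div_assoc]
    gcongr
    exact_mod_cast I.newDst_le_two_mul v.2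
  · intro v hv hS
    obtain ⟨w, hw, hg⟩ := I.exists_good v.2 (hvt v hv) hS
    obtain ⟨hv', hw', h⟩ := id hw
    have hadj : I.graph.Adj v ⟨w, hw'⟩ := h
    refine ⟨⟨w, hw'⟩, hadj, ?_, ?_⟩
    · rw [← NNReal.coe_eq_zero, I.config_eq, I.charge_of_free (.inl hg)]
      simp
    · exact (I.edgeVal_le_iff hadj).1 hg.2
  · intro v w h
    rw [I.config_eq, I.graph_cost_eq h, ← add_div, ← add_div]
    gcongr
    exact_mod_cast I.newDst_le v.2 w.2
  · intro v hv
    obtain ⟨w, hw, he⟩ := I.exists_newDst_eq v.2 (hvt v hv)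
    obtain ⟨hv', hw', h⟩ := id hw
    have hadj : I.graph.Adj v ⟨w, hw'⟩ := h
    refine ⟨⟨w, hw'⟩, hadj, ?_⟩
    rw [I.config_eq, I.graph_cost_eq hadj, ← add_div, ← add_div]
    congr 1
    exact_mod_cast he
  · intro v w h
    have htight : I.Tight v w →
        (I.graph.cost v w : ℝ) + I.dst w / I.scale = I.dst v / I.scale := fun ht => by
      rw [I.graph_cost_eq h, ← add_div]
      congr 1
      exact_mod_cast le_antisymm ht (I.dst_le v.2 w.2)
    by_cases hf : I.Free v w
    · have h0 : ((I.config v w : ℚ≥0) : ℝ≥0) = 0 := by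
        rw [← NNReal.coe_eq_zero, I.config_eq, I.charge_of_free hf]; simp
      rcases hf with hg | ⟨hS, ht⟩
      · exact .inl ⟨I.bottleneck_le_of_good v.2 w.2 hg, hg.1, h0⟩
      · exact .inr (.inl ⟨hS, htight ht, h0⟩)
    · by_cases ht : I.Tight v w
      · refine .inr (.inr (.inl ⟨?_, htight ht, ?_⟩))
        · by_contra hS; exact hf (.inr ⟨hS, ht⟩)
        · rw [I.config_eq, I.graph_cost_eq h, ← add_div, ← add_div, ← mul_div_assoc]
          congr 1
          exact_mod_cast I.cst_add_charge_of_tight w.2 hf ht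
      · refine .inr (.inr (.inr ?_))
        rw [I.config_eq, I.charge_of_not_tight hf ht]
        have h1 := I.newDst_le_two_mul v.2
        constructor
        · -- A blocked edge costs more than the reward since `1 ≤ bias`.
          have hb1 : (1 : ℝ) ≤ I.bias := by exact_mod_cast I.bias_pos
          rw [← mul_div_assoc]
          have h2 : 2 * (I.opt : ℝ) / (I.bias * I.scale) ≤ 2 * (I.opt : ℝ) / I.scale :=
            div_le_div_of_nonneg_left (by positivity) hN (by nlinarith)
          refine h2.trans_lt ?_
          gcongr
          exact_mod_cast (by omega : 2 * I.opt < 2 * I.dst v + 2 * I.opt + 1)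
        · gcongr
          exact_mod_cast (by omega : I.newDst v < 2 * I.dst v + 2 * I.opt + 1)

lemma optReward_le_reward : I.graph.optReward I.biasSet ≤ (I.reward : ℝ) :=
  csInf_le ⟨0, fun _ h => h.1⟩ ⟨NNRat.cast_nonneg _, _, I.motivatingForAll_config⟩

lemma reward_le_two_mul : (I.reward : ℝ) ≤ 2 * I.graph.optReward I.biasSet := by
  have hbias : (0 : ℝ) < I.bias := by exact_mod_cast I.bias_pos
  have hN : (0 : ℝ) < I.scale := by exact_mod_cast I.scale_pos
  rw [reward_eq]
  refine mul_le_mul_of_nonneg_left ?_ two_pos.le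
  refine le_csInf ⟨_, NNRat.cast_nonneg _, _, I.motivatingForAll_config⟩ ?_
  rintro r ⟨hr, e, hmot⟩
  obtain ⟨p, hp, hpb⟩ := I.exists_bias_eq
  have hb : (I.bias / I.scale : ℝ) = p.1 := by rw [hpb]; field_simp
  have hmem : (I.bias / I.scale : ℝ) ∈ I.biasSet :=
    ⟨p, hp, hb.ge, by rw [hb]; exact_mod_cast (I.intervals_valid p hp).2.1⟩
  refine I.graph.le_of_motivating e (div_pos hbias hN) hr (hmot _ hmem)
    (fun v => (I.bottleneck v : ℝ) / (I.bias * I.scale)) ?_ ?_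
  · have : I.bottleneck (I.graph.t : ℕ) = 0 := I.bottleneck_t
    simp [this]
  · intro v w h
    have e1 : (I.graph.cost v w : ℝ) / (I.bias / I.scale) + I.graph.dist w =
        (I.edgeVal v w : ℝ) / (I.bias * I.scale) := by
      rw [I.graph_cost_eq h, I.dist_eq, edgeVal]; push_cast; field_simp
    rw [e1, max_div_div_right (by positivity)]
    gcongr
    exact_mod_cast I.bottleneck_le v.2 w.2

end UPBInstance

/-! ### The program -/

namespace RAM

/-- The node `s`. -/
def sE : Exp := .load 0 (.lit 1)

/-- The node `t`. -/
def tE : Exp := .load 0 (.lit 2)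

/-- The number of intervals. -/
def intervalsE : Exp := .load 0 (.lit 3)

/-- The position of the cost matrix in the input. -/
def baseE : Exp := .add (.lit 4) (.mul (.lit 4) intervalsE)

/-- The length of the input. -/
def lenE : Exp := .add baseE (.mul (.lit 2) (.mul nE nE))

/-- The common denominator, from array `3`. -/
def scaleE : Exp := .load 3 lenE

/-- The scaled minimum of the present bias set, from array `4`. -/
def biasE : Exp := .load 4 intervalsE

/-- The number that stands for an infinite cost. -/
def infinityE : Exp :=
  .mul (.mul (.add scaleE (.lit 1)) (.add scaleE (.lit 1))) (.add scaleE (.lit 1))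

/-- The scaled cost of `(v, w)`, from array `5`. -/
def cstE (v w : Exp) : Exp := .load 5 (.add (.mul v nE) w)

/-- The scaled distance to `t`, from array `6`. -/
def dstE (v : Exp) : Exp := finalE 6 v

/-- The scaled value of `(v, w)` for minmax paths. -/
def edgeValE (v w : Exp) : Exp := .add (.mul (cstE v w) scaleE) (.mul (dstE w) biasE)

/-- The minmax value of the paths from `v`, from array `7`. -/
def bottleneckE (v : Exp) : Exp := finalE 7 v

/-- The minmax value at `s`. -/
def optE : Exp := bottleneckE sE

/-- The indicator of tight edges. -/
def tightE (v w : Exp) : Exp := .le (.add (cstE v w) (dstE w)) (dstE v)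

/-- The indicator of free edges. -/
def freeE (v w : Exp) : Exp :=
  .max (.mul (.le (bottleneckE w) optE) (.le (edgeValE v w) optE))
    (.mul (.sub (.lit 1) (.le (bottleneckE v) optE)) (tightE v w))

/-- The distance to `t` after charging, from array `8`. -/
def newDstE (v : Exp) : Exp := finalE 8 v

/-- The scaled charge for `(v, w)`. -/
def chargeE (v w : Exp) : Exp :=
  .cond (freeE v w) (.lit 0)
    (.cond (tightE v w)
      (.sub (.mul (.lit 2) (dstE v)) (.add (cstE v w) (newDstE w)))
      (.add (.add (.mul (.lit 2) (dstE v)) (.mul (.lit 2) optE)) (.lit 1)))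

/-- `0` at the node `t`, and `y` elsewhere. -/
def atT (v y : Exp) : Exp := .cond (.mul (.le v tE) (.le tE v)) (.lit 0) y

/-- The number of cells to be filled in array `a`. -/
def boundE : ℕ → Exp
  | 3 => .add lenE (.lit 1)
  | 4 => .add intervalsE (.lit 1)
  | 5 => .mul nE nE
  | 6 | 7 | 8 => .mul (.mul nE nE) (.add nE (.lit 1))
  | _ => .add (.lit 2) (.mul (.lit 2) (.mul nE nE))

/-- The contents to be filled into array `a`. -/
def bodyE : ℕ → Exp
  | 3 =>
    let p := Exp.sub counter (.lit 1)
    .cond (.le counter (.lit 0)) (.lit 1) (.mul (.load 3 p) (.max (.lit 1) (.load 0 p)))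
  | 4 =>
    let p := Exp.sub counter (.lit 1)
    let i := Exp.add (.lit 4) (.mul (.lit 4) p)
    .cond (.le counter (.lit 0)) scaleE
      (.min (.load 4 p) (.div (.mul (.load 0 i) scaleE) (.load 0 (.add i (.lit 1)))))
  | 5 =>
    let i := Exp.add baseE (.mul (.lit 2) counter)
    .cond (.le (.load 0 (.add i (.lit 1))) (.lit 0)) infinityE
      (.div (.mul (.load 0 i) scaleE) (.load 0 (.add i (.lit 1))))
  | 6 => tableE 6 (fun v => atT v infinityE) fun v w x => .add (cstE v w) x
  | 7 => tableE 7 (fun v => atT v (.mul infinityE scaleE)) fun v w x => .max (edgeValE v w) x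
  | 8 => tableE 8 (fun v => .mul (.lit 2) (dstE v)) fun v w x =>
      .add (.add (cstE v w) x) (.cond (freeE v w) (.lit 0) (.mul (.lit 2) (dstE v)))
  | _ =>
    let i := Exp.div (.sub counter (.lit 2)) (.lit 2)
    .cond (.le (.lit 1) (.mod counter (.lit 2))) (.mul biasE scaleE)
      (.cond (.le counter (.lit 0)) (.mul (.lit 2) optE)
        (.mul (chargeE (.div i nE) (.mod i nE)) biasE))

/-- The loop that fills array `a`. -/
def stage (a : ℕ) : Prog := fill a (boundE a) (bodyE a)

/-- The approximation algorithm. -/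
def approx : Prog :=
  .seq (stage 3) (.seq (stage 4) (.seq (stage 5) (.seq (stage 6) (.seq (stage 7)
    (.seq (stage 8) (stage 1))))))

/-- The sum of the weights of the stages. -/
def approxWeight : ℕ :=
  ([3, 4, 5, 6, 7, 8, 1].map fun a => fillWeight (boundE a) (bodyE a)).sum

end RAM

namespace UPBInstance

open RAM

variable {I : UPBInstance}

/-- The contents of the output array: numerators at even positions, the reward first and then the
charges row by row, and the common denominator `bias * scale` at odd positions. -/
def output (I : UPBInstance) (j : ℕ) : ℕ :=
  if 1 ≤ j % 2 then I.bias * I.scale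
  else if j ≤ 0 then 2 * I.opt
  else I.charge ((j - 2) / 2 / I.n) ((j - 2) / 2 % I.n) * I.bias

/-- The number of cells used of array `a`, with the same convention as `table`. -/
def tableSize (I : UPBInstance) : ℕ → ℕ
  | 3 => I.base + 2 * (I.n * I.n) + 1
  | 4 => I.intervals.length + 1
  | 5 => I.n * I.n
  | 6 | 7 | 8 => I.n * I.n * (I.n + 1)
  | _ => 2 + 2 * (I.n * I.n)

/-- The intended contents of array `a`, where every `a` outside `3, …, 8` stands for the output. -/
def table (I : UPBInstance) : ℕ → ℕ → ℕ
  | 3 => I.prods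
  | 4 => I.biasMin
  | 5 => I.costEntry
  | 6 => tableEntry I.n (fun v => if v = (I.t : ℕ) then 0 else I.infinity)
      (fun v w x => I.cst v w + x)
  | 7 => tableEntry I.n (fun v => if v = (I.t : ℕ) then 0 else I.infinity * I.scale)
      (fun v w x => max (I.edgeVal v w) x)
  | 8 => tableEntry I.n (fun v => 2 * I.dst v)
      (fun v w x => I.cst v w + x + if I.Free v w then 0 else 2 * I.dst v)
  | _ => I.output

/-- The memory holds the input, and the arrays `3, …, a - 1` have been filled. -/
structure FilledTo (I : UPBInstance) (a : ℕ) (τ : Mem) : Prop where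
  input : τ 0 = I.inp
  filled : ∀ c, 3 ≤ c → c < a → ∀ j < I.tableSize c, τ c j = I.table c j

lemma table_dst : I.table 6 =
    tableEntry I.n (fun v => if v = (I.t : ℕ) then 0 else I.infinity)
      (fun v w x => I.cst v w + x) := rfl

lemma table_bottleneck : I.table 7 =
    tableEntry I.n (fun v => if v = (I.t : ℕ) then 0 else I.infinity * I.scale)
      (fun v w x => max (I.edgeVal v w) x) := rfl

lemma table_newDst : I.table 8 =
    tableEntry I.n (fun v => 2 * I.dst v)
      (fun v w x => I.cst v w + x + if I.Free v w then 0 else 2 * I.dst v) := rfl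

variable {a : ℕ} {τ : Mem}

lemma FilledTo.congr (h : I.FilledTo a τ) {b : ℕ} (hb : b = 1 ∨ a ≤ b) (hb0 : b ≠ 0) {υ : Mem}
    (hυ : ∀ c, c ≠ b → c ≠ 2 → υ c = τ c) : I.FilledTo a υ where
  input := (hυ 0 hb0.symm (by omega)).trans h.input
  filled c h3 hc j hj := by rw [hυ c (by omega) (by omega)]; exact h.filled c h3 hc j hj

lemma eval_nE (h : I.FilledTo a τ) : nE.eval τ = I.n := congrFun h.input 0

lemma eval_sE (h : I.FilledTo a τ) : sE.eval τ = I.s := congrFun h.input 1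

lemma eval_tE (h : I.FilledTo a τ) : tE.eval τ = I.t := congrFun h.input 2

lemma eval_intervalsE (h : I.FilledTo a τ) : intervalsE.eval τ = I.intervals.length :=
  congrFun h.input 3

lemma eval_baseE (h : I.FilledTo a τ) : baseE.eval τ = I.base := by
  simp only [baseE, Exp.eval, eval_intervalsE h, base]

lemma eval_lenE (h : I.FilledTo a τ) : lenE.eval τ = I.base + 2 * (I.n * I.n) := by
  simp only [lenE, Exp.eval, eval_baseE h, eval_nE h]

lemma eval_input (h : I.FilledTo a τ) (x : Exp) : (Exp.load 0 x).eval τ = I.inp (x.eval τ) :=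
  congrFun h.input _

lemma eval_scaleE (h : I.FilledTo a τ) (ha : 3 < a) : scaleE.eval τ = I.scale := by
  simp only [scaleE, Exp.eval, eval_lenE h]
  exact h.filled 3 le_rfl ha _ (Nat.lt_succ_self _)

lemma eval_biasE (h : I.FilledTo a τ) (ha : 4 < a) : biasE.eval τ = I.bias := by
  simp only [biasE, Exp.eval, eval_intervalsE h]
  exact h.filled 4 (by omega) ha _ (Nat.lt_succ_self _)

lemma eval_infinityE (h : I.FilledTo a τ) (ha : 3 < a) : infinityE.eval τ = I.infinity := by
  simp only [infinityE, Exp.eval, eval_scaleE h ha, infinity]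

lemma eval_cstE (h : I.FilledTo a τ) (ha : 5 < a) {v w : Exp} (hv : v.eval τ < I.n)
    (hw : w.eval τ < I.n) : (cstE v w).eval τ = I.cst (v.eval τ) (w.eval τ) := by
  simp only [cstE, Exp.eval, eval_nE h]
  refine h.filled 5 (by omega) ha _ ?_
  change v.eval τ * I.n + w.eval τ < I.n * I.n
  nlinarith

lemma eval_dstE (h : I.FilledTo a τ) (ha : 6 < a) {v : Exp} (hv : v.eval τ < I.n) :
    (dstE v).eval τ = I.dst (v.eval τ) :=
  eval_finalE (eval_nE h)
    (fun i hi => (h.filled 6 (by omega) ha i hi).trans (congrFun table_dst i)) hv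

lemma eval_edgeValE (h : I.FilledTo a τ) (ha : 6 < a) {v w : Exp} (hv : v.eval τ < I.n)
    (hw : w.eval τ < I.n) : (edgeValE v w).eval τ = I.edgeVal (v.eval τ) (w.eval τ) := by
  simp only [edgeValE, Exp.eval, eval_cstE h (by omega) hv hw, eval_dstE h ha hw,
    eval_scaleE h (by omega), eval_biasE h (by omega), edgeVal]

lemma eval_bottleneckE (h : I.FilledTo a τ) (ha : 7 < a) {v : Exp} (hv : v.eval τ < I.n) :
    (bottleneckE v).eval τ = I.bottleneck (v.eval τ) :=
  eval_finalE (eval_nE h)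
    (fun i hi => (h.filled 7 (by omega) ha i hi).trans (congrFun table_bottleneck i)) hv

lemma eval_optE (h : I.FilledTo a τ) (ha : 7 < a) : optE.eval τ = I.opt := by
  rw [optE, eval_bottleneckE h ha (by rw [eval_sE h]; exact I.s.2), eval_sE h, opt]

lemma eval_tightE (h : I.FilledTo a τ) (ha : 6 < a) {v w : Exp} (hv : v.eval τ < I.n)
    (hw : w.eval τ < I.n) :
    (tightE v w).eval τ = if I.Tight (v.eval τ) (w.eval τ) then 1 else 0 := by
  simp only [tightE, Exp.eval_le, Exp.eval, eval_cstE h (by omega) hv hw, eval_dstE h ha hw,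
    eval_dstE h ha hv]
  rfl

lemma eval_freeE (h : I.FilledTo a τ) (ha : 7 < a) {v w : Exp} (hv : v.eval τ < I.n)
    (hw : w.eval τ < I.n) :
    (freeE v w).eval τ = if I.Free (v.eval τ) (w.eval τ) then 1 else 0 := by
  simp only [freeE, Exp.eval_max, Exp.eval_le, Exp.eval, eval_tightE h (by omega) hv hw,
    eval_bottleneckE h ha hv, eval_bottleneckE h ha hw, eval_optE h ha,
    eval_edgeValE h (by omega) hv hw, Free, Good]
  by_cases h1 : I.bottleneck (w.eval τ) ≤ I.opt <;>
  by_cases h2 : I.edgeVal (v.eval τ) (w.eval τ) ≤ I.opt <;>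
  by_cases h3 : I.bottleneck (v.eval τ) ≤ I.opt <;>
  by_cases h4 : I.Tight (v.eval τ) (w.eval τ) <;> simp [h1, h2, h3, h4]

lemma eval_newDstE (h : I.FilledTo a τ) (ha : 8 < a) {v : Exp} (hv : v.eval τ < I.n) :
    (newDstE v).eval τ = I.newDst (v.eval τ) :=
  eval_finalE (eval_nE h)
    (fun i hi => (h.filled 8 (by omega) ha i hi).trans (congrFun table_newDst i)) hv

lemma eval_chargeE (h : I.FilledTo a τ) (ha : 8 < a) {v w : Exp} (hv : v.eval τ < I.n)
    (hw : w.eval τ < I.n) : (chargeE v w).eval τ = I.charge (v.eval τ) (w.eval τ) := by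
  rw [chargeE, Exp.eval_cond (hc := eval_freeE h (by omega) hv hw),
    Exp.eval_cond (hc := eval_tightE h (by omega) hv hw)]
  simp only [Exp.eval, eval_dstE h (by omega) hv, eval_cstE h (by omega) hv hw,
    eval_newDstE h ha hw, eval_optE h (by omega), charge]

lemma eval_atT (h : I.FilledTo a τ) (v y : Exp) :
    (atT v y).eval τ = if v.eval τ = (I.t : ℕ) then 0 else y.eval τ := by
  rw [atT, Exp.eval_cond (p := v.eval τ = (I.t : ℕ))]
  · rfl
  · simp only [Exp.eval, Exp.eval_le, eval_tE h]
    split_ifs <;> omega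

lemma eval_boundE (h : I.FilledTo a τ) {b : ℕ} (hb : b ∈ [3, 4, 5, 6, 7, 8, 1]) :
    (boundE b).eval τ = I.tableSize b := by
  simp only [List.mem_cons, List.not_mem_nil, or_false] at hb
  rcases hb with rfl | rfl | rfl | rfl | rfl | rfl | rfl <;>
  simp only [boundE, tableSize, Exp.eval, eval_lenE h, eval_nE h, eval_intervalsE h]

lemma eval_bodyE (h : I.FilledTo a τ) (ha : a ∈ [3, 4, 5, 6, 7, 8]) {j : ℕ}
    (hc : τ 2 0 = j) (hprev : ∀ i < j, τ a i = I.table a i) :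
    (bodyE a).eval τ = I.table a j := by
  have hn0 : 0 < I.n := I.s.pos
  have hcounter : counter.eval τ = j := hc
  have hfirst : (Exp.le counter (.lit 0)).eval τ = if j ≤ 0 then 1 else 0 := by
    rw [Exp.eval_le, hcounter]; rfl
  simp only [List.mem_cons, List.not_mem_nil, or_false] at ha
  rcases ha with rfl | rfl | rfl | rfl | rfl | rfl
  · rw [bodyE, Exp.eval_cond (hc := hfirst)]
    simp only [Exp.eval, Exp.eval_max, hcounter]
    rcases j with _ | j
    · rfl
    · rw [if_neg (by omega), Nat.add_sub_cancel, hprev j (by omega), congrFun h.input j]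
      exact (Finset.prod_range_succ _ _).symm
  · rw [bodyE, Exp.eval_cond (hc := hfirst)]
    simp only [eval_scaleE h (by omega), Exp.eval_min, Exp.eval, hcounter]
    rcases j with _ | j
    · rfl
    · rw [if_neg (by omega), Nat.add_sub_cancel, hprev j (by omega), h.input]
      rfl
  · have hi : (Exp.le (.load 0 (.add (.add baseE (.mul (.lit 2) counter)) (.lit 1)))
        (.lit 0)).eval τ = if I.inp (I.base + 2 * j + 1) ≤ 0 then 1 else 0 := by
      rw [Exp.eval_le, eval_input h]
      simp only [Exp.eval, eval_baseE h, hcounter]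
    rw [bodyE, Exp.eval_cond (hc := hi)]
    simp only [Exp.eval, h.input, eval_baseE h, hcounter, eval_scaleE h (by omega),
      eval_infinityE h (by omega)]
    rfl
  · rw [table_dst] at hprev ⊢
    rw [bodyE]
    refine eval_tableE (eval_nE h) hn0 hc hprev (fun v hv => ?_) fun v w x hv hw => ?_
    · rw [eval_atT h, eval_infinityE h (by omega)]
    · simp only [Exp.eval, eval_cstE h (by omega) hv hw]
  · rw [table_bottleneck] at hprev ⊢
    rw [bodyE]
    refine eval_tableE (eval_nE h) hn0 hc hprev (fun v hv => ?_) fun v w x hv hw => ?_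
    · simp only [eval_atT h, Exp.eval, eval_infinityE h (by omega), eval_scaleE h (by omega)]
    · simp only [Exp.eval_max, eval_edgeValE h (by omega) hv hw]
  · rw [table_newDst] at hprev ⊢
    rw [bodyE]
    refine eval_tableE (eval_nE h) hn0 hc hprev (fun v hv => ?_) fun v w x hv hw => ?_
    · simp only [Exp.eval, eval_dstE h (by omega) hv]
    · simp only [Exp.eval, Exp.eval_cond (hc := eval_freeE h (by omega) hv hw),
        eval_cstE h (by omega) hv hw, eval_dstE h (by omega) hv]

lemma eval_bodyE_output (h : I.FilledTo 9 τ) {j : ℕ} (hj : j < I.tableSize 1)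
    (hc : τ 2 0 = j) : (bodyE 1).eval τ = I.output j := by
  have hn0 : 0 < I.n := I.s.pos
  have hcounter : counter.eval τ = j := hc
  have hfirst : (Exp.le counter (.lit 0)).eval τ = if j ≤ 0 then 1 else 0 := by
    rw [Exp.eval_le, hcounter]; rfl
  have hodd : (Exp.le (.lit 1) (.mod counter (.lit 2))).eval τ = if 1 ≤ j % 2 then 1 else 0 := by
    rw [Exp.eval_le, Exp.eval_mod, hcounter]; rfl
  have hj' : j < 2 + 2 * (I.n * I.n) := hj
  have hi : (j - 2) / 2 < I.n * I.n := by
    have : 0 < I.n * I.n := Nat.mul_pos hn0 hn0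
    omega
  simp only [bodyE]
  rw [Exp.eval_cond (hc := hodd), Exp.eval_cond (hc := hfirst)]
  simp only [Exp.eval, eval_optE h (by omega), eval_biasE h (by omega), eval_scaleE h (by omega)]
  rw [eval_chargeE h (by omega)]
  · simp only [Exp.eval, Exp.eval_mod, hcounter, eval_nE h]
    rfl
  · simp only [Exp.eval, hcounter, eval_nE h]
    exact Nat.div_lt_of_lt_mul hi
  · simp only [Exp.eval, Exp.eval_mod, hcounter, eval_nE h]
    exact Nat.mod_lt _ hn0

/-! ### The polynomial time bound -/

/-- A bound on the lengths of all numbers in the computation. -/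
def bits (I : UPBInstance) : ℕ := 9 * (inputSize I.encode + 1)

lemma base_add_le : I.base + 2 * (I.n * I.n) ≤ inputSize I.encode :=
  I.length_encode ▸ I.length_encode_le

lemma tableSize_le {b : ℕ} (hb : b ∈ [3, 4, 5, 6, 7, 8, 1]) :
    I.tableSize b + 2 ≤ (inputSize I.encode + 3) ^ 3 := by
  have h1 := I.base_add_le
  have h2 : I.n ≤ I.n * I.n := Nat.le_mul_self _
  rw [base] at h1
  generalize inputSize I.encode = L at h1 ⊢
  have h3 : L + 3 ≤ (L + 3) ^ 3 := Nat.le_self_pow (by omega) _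
  simp only [List.mem_cons, List.not_mem_nil, or_false] at hb
  rcases hb with rfl | rfl | rfl | rfl | rfl | rfl | rfl <;> simp only [tableSize, base]
  · omega
  · omega
  · omega
  iterate 3
    · have h4 : I.n * I.n * (I.n + 1) ≤ L * (L + 1) := Nat.mul_le_mul (by omega) (by omega)
      nlinarith
  · omega

/-- Every number in the computation is at most `(scale + 1) ^ 8`, so this bounds its length. -/
lemma lt_two_pow_bits {x : ℕ} (h : x ≤ (I.scale + 1) ^ 8) : x < 2 ^ I.bits := by
  have h1 : I.scale + 1 ≤ 2 ^ (inputSize I.encode + 1) := by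
    have := I.scale_le
    have := Nat.one_le_two_pow (n := inputSize I.encode)
    rw [pow_succ]; omega
  have h2 : (I.scale + 1) ^ 8 < (I.scale + 1) ^ 9 :=
    Nat.pow_lt_pow_right (by have := I.scale_pos; omega) (by omega)
  have h3 : (I.scale + 1) ^ 9 ≤ 2 ^ I.bits := by
    rw [bits, mul_comm, pow_mul]; exact Nat.pow_le_pow_left h1 9
  omega

lemma tableSize_lt {b : ℕ} (hb : b ∈ [3, 4, 5, 6, 7, 8, 1]) : I.tableSize b < 2 ^ I.bits := by
  have h1 := tableSize_le (I := I) hb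
  have h2 : inputSize I.encode + 3 ≤ 2 ^ (3 * (inputSize I.encode + 1)) := by
    have := Nat.lt_two_pow_self (n := inputSize I.encode)
    have h3 : 2 ^ (inputSize I.encode + 2) ≤ 2 ^ (3 * (inputSize I.encode + 1)) :=
      Nat.pow_le_pow_right two_pos (by omega)
    have := Nat.one_le_two_pow (n := inputSize I.encode)
    rw [pow_add] at h3
    omega
  have h3 : (inputSize I.encode + 3) ^ 3 ≤ 2 ^ I.bits := by
    refine (Nat.pow_le_pow_left h2 3).trans ?_
    rw [← pow_mul, bits]
    exact Nat.pow_le_pow_right two_pos (by omega)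
  omega

lemma inp_lt_bits (i : ℕ) : I.inp i < 2 ^ I.bits :=
  (I.inp_lt i).trans_le (Nat.pow_le_pow_right two_pos (by rw [bits]; omega))

lemma table_lt {b : ℕ} (hb : b ∈ [3, 4, 5, 6, 7, 8, 1]) {j : ℕ} (hj : j < I.tableSize b) :
    I.table b j < 2 ^ I.bits := by
  have hn0 : 0 < I.n := I.s.pos
  have hS := I.scale_pos
  have hmod (j : ℕ) : j / (I.n + 1) % I.n < I.n := Nat.mod_lt _ hn0
  have hpow {i k : ℕ} (h : i ≤ k) : (I.scale + 1) ^ i ≤ (I.scale + 1) ^ k :=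
    Nat.pow_le_pow_right (Nat.succ_pos _) h
  have hinf : I.infinity = (I.scale + 1) ^ 3 := by rw [infinity]; ring
  have hinf' : I.infinity * I.scale ≤ (I.scale + 1) ^ 4 := by
    rw [hinf, pow_succ _ 3]; exact Nat.mul_le_mul_left _ (Nat.le_succ _)
  have hscale : I.scale ≤ (I.scale + 1) ^ 1 := by simp
  have htwo (k : ℕ) : 2 * (I.scale + 1) ^ k ≤ (I.scale + 1) ^ (k + 1) := by
    rw [pow_succ, mul_comm]; exact Nat.mul_le_mul_left _ (by omega)
  have hp4 := hpow (i := 4) (k := 8) (by omega)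
  have hp3 := hpow (i := 3) (k := 4) (by omega)
  have hp1 := hpow (i := 1) (k := 3) (by omega)
  refine lt_two_pow_bits ?_
  simp only [List.mem_cons, List.not_mem_nil, or_false] at hb
  rcases hb with rfl | rfl | rfl | rfl | rfl | rfl | rfl
  · have := I.prods_le (Nat.lt_succ_iff.1 hj)
    change I.prods j ≤ _
    omega
  · have : I.biasMin j ≤ I.scale := runMin_le_init _ _ _
    change I.biasMin j ≤ _
    omega
  · change I.costEntry j ≤ _
    rw [costEntry]
    split_ifs
    · omega
    · have hj' : j < I.n * I.n := hj
      refine (Nat.div_le_self _ _).trans ?_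
      have := Nat.mul_le_mul (I.inp_le_scale (i := I.base + 2 * j) (by omega)) hscale
      have h2 : I.scale * (I.scale + 1) ^ 1 ≤ (I.scale + 1) ^ 2 := by nlinarith
      have := hpow (i := 2) (k := 3) (by omega)
      omega
  · refine (runMin_le_init _ _ _).trans ?_
    dsimp only
    split_ifs <;> omega
  · refine (runMin_le_init _ _ _).trans ?_
    dsimp only
    split_ifs <;> omega
  · have h1 := I.dst_lt (hmod j)
    have h2 : 2 * (I.scale + 1) ^ 3 ≤ (I.scale + 1) ^ 4 := htwo 3
    refine (runMin_le_init _ _ _).trans ?_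
    dsimp only
    omega
  · have hj' : j < 2 + 2 * (I.n * I.n) := hj
    have hi : (j - 2) / 2 < I.n * I.n := by
      have : 0 < I.n * I.n := Nat.mul_pos hn0 hn0
      omega
    have hopt := I.opt_lt
    have h3 : 2 * (I.scale + 1) ^ 3 ≤ (I.scale + 1) ^ 4 := htwo 3
    have h4 : 2 * (I.scale + 1) ^ 4 ≤ (I.scale + 1) ^ 5 := htwo 4
    have h5 : 2 * (I.scale + 1) ^ 5 ≤ (I.scale + 1) ^ 6 := htwo 5
    have h6 := hpow (i := 4) (k := 5) (by omega)
    have h8 := hpow (i := 5) (k := 8) (by omega)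
    have h7 := hpow (i := 6) (k := 7) (by omega)
    change I.output j ≤ _
    rw [output]
    split_ifs
    · have := Nat.mul_le_mul (I.bias_le_scale.trans hscale) hscale
      rw [← pow_add] at this
      have := hpow (i := 1 + 1) (k := 8) (by omega)
      omega
    · omega
    · have hd := I.dst_lt (Nat.div_lt_of_lt_mul hi)
      have hc : I.charge ((j - 2) / 2 / I.n) ((j - 2) / 2 % I.n) ≤ (I.scale + 1) ^ 7 := by
        rw [charge]
        split_ifs <;> omega
      have := Nat.mul_le_mul hc (I.bias_le_scale.trans hscale)
      rwa [← pow_add] at this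

lemma exec_stage {b : ℕ} (hb : b ∈ [3, 4, 5, 6, 7, 8, 1]) {σ : Mem}
    (hσ : ∀ c i, σ c i < 2 ^ I.bits) (h : I.FilledTo a σ) (hab : b = 1 ∨ a ≤ b)
    (hbody : ∀ τ, I.FilledTo a τ → ∀ j < I.tableSize b, τ 2 0 = j →
      (∀ i < j, τ b i = I.table b i) → (bodyE b).eval τ = I.table b j) :
    ∃ τ T, Exec (stage b) σ τ T ∧
      T ≤ fillWeight (boundE b) (bodyE b) * (2 * I.bits * (inputSize I.encode + 3) ^ 3) ∧
      (∀ c i, τ c i < 2 ^ I.bits) ∧ I.FilledTo a τ ∧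
      ∀ j < I.tableSize b, τ b j = I.table b j := by
  have hb2 : b ≠ 2 ∧ b ≠ 0 := by
    constructor <;> rintro rfl <;> simp at hb
  obtain ⟨τ, T, he, hT, hτ, hfr, hfill⟩ := exec_fill hb2.1 (g := I.table b)
    (by rw [bits]; omega) hσ (tableSize_lt hb) (fun j hj => table_lt hb hj)
    (fun τ hτ => eval_boundE (h.congr hab hb2.2 hτ) hb)
    (fun j hj τ hτ hc hprev => hbody τ (h.congr hab hb2.2 hτ) j hj hc hprev)
  refine ⟨τ, T, he, hT.trans ?_, hτ, h.congr hab hb2.2 hfr, hfill⟩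
  calc _ ≤ 2 * fillWeight (boundE b) (bodyE b) * I.bits * (inputSize I.encode + 3) ^ 3 :=
        Nat.mul_le_mul_left _ (tableSize_le hb)
    _ = _ := by ring

lemma exec_table_stage (ha : a ∈ [3, 4, 5, 6, 7, 8]) {σ : Mem}
    (hσ : ∀ c i, σ c i < 2 ^ I.bits) (h : I.FilledTo a σ) :
    ∃ τ T, Exec (stage a) σ τ T ∧
      T ≤ fillWeight (boundE a) (bodyE a) * (2 * I.bits * (inputSize I.encode + 3) ^ 3) ∧
      (∀ c i, τ c i < 2 ^ I.bits) ∧ I.FilledTo (a + 1) τ := by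
  obtain ⟨τ, T, he, hT, hτ, h', hfill⟩ := exec_stage (a := a) (b := a)
    (List.mem_append_left [1] ha) hσ h (.inr le_rfl)
    fun τ hτ j _ hc hprev => eval_bodyE hτ ha hc hprev
  refine ⟨τ, T, he, hT, hτ, h'.input, fun c h3 hc => ?_⟩
  rcases Nat.lt_succ_iff_lt_or_eq.1 hc with hc | rfl
  · exact h'.filled c h3 hc
  · exact hfill

lemma exec_approx (I : UPBInstance) : ∃ τ T, Exec approx (init I.encode) τ T ∧
    T ≤ approxWeight * (2 * I.bits * (inputSize I.encode + 3) ^ 3) ∧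
    ∀ j < I.tableSize 1, τ 1 j = I.output j := by
  have h0 : I.FilledTo 3 (init I.encode) := ⟨rfl, fun c h1 h2 => by omega⟩
  have hσ : ∀ c i, init I.encode c i < 2 ^ I.bits := by
    intro c i
    unfold init
    split_ifs
    · exact inp_lt_bits i
    · exact Nat.two_pow_pos _
  obtain ⟨τ₃, T₃, e₃, b₃, hσ, h⟩ := exec_table_stage (a := 3) (by simp) hσ h0
  obtain ⟨τ₄, T₄, e₄, b₄, hσ, h⟩ := exec_table_stage (a := 4) (by simp) hσ h
  obtain ⟨τ₅, T₅, e₅, b₅, hσ, h⟩ := exec_table_stage (a := 5) (by simp) hσ h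
  obtain ⟨τ₆, T₆, e₆, b₆, hσ, h⟩ := exec_table_stage (a := 6) (by simp) hσ h
  obtain ⟨τ₇, T₇, e₇, b₇, hσ, h⟩ := exec_table_stage (a := 7) (by simp) hσ h
  obtain ⟨τ₈, T₈, e₈, b₈, hσ, h⟩ := exec_table_stage (a := 8) (by simp) hσ h
  obtain ⟨τ₁, T₁, e₁, b₁, -, -, hout⟩ := exec_stage (b := 1) (by simp) hσ h (.inl rfl)
    fun τ hτ j hj hc _ => eval_bodyE_output hτ hj hc
  refine ⟨τ₁, _, e₃.seq (e₄.seq (e₅.seq (e₆.seq (e₇.seq (e₈.seq e₁))))), ?_, hout⟩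
  simp only [approxWeight, List.map_cons, List.map_nil, List.sum_cons, List.sum_nil, add_zero,
    add_mul]
  omega

end UPBInstance

/-- There are a program and a polynomial bounding its running time such that, on every instance,
the program outputs a reward `ρ` and a cost configuration `e` (row by row), where `e` is motivating
for all `β ∈ B` under the reward `ρ`, and `ρ` is at least `r(G, B)` and at most `2 r(G, B)`. -/
theorem corollary2 :
    ∃ (p : RAM.Prog) (P : Polynomial ℕ), ∀ I : UPBInstance,
      ∃ (σ : RAM.Mem) (T : ℕ) (ρ : ℚ≥0) (e : Fin I.n → Fin I.n → ℚ≥0),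
        RAM.Exec p (RAM.init I.encode) σ T ∧
        T ≤ P.eval (RAM.inputSize I.encode) ∧
        RAM.OutputsRat σ 0 ρ ∧
        (∀ u v : Fin I.n, RAM.OutputsRat σ (2 + 2 * ((u : ℕ) * I.n + (v : ℕ))) (e u v)) ∧
        I.graph.MotivatingForAll I.biasSet (fun u v => ((e u v : ℚ≥0) : ℝ≥0)) (ρ : ℝ) ∧
        I.graph.optReward I.biasSet ≤ (ρ : ℝ) ∧
        (ρ : ℝ) ≤ 2 * I.graph.optReward I.biasSet := by
  refine ⟨RAM.approx, Polynomial.C RAM.approxWeight *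
    (2 * (9 * (Polynomial.X + 1)) * (Polynomial.X + 3) ^ 3), fun I => ?_⟩
  obtain ⟨σ, T, he, hT, hout⟩ := I.exec_approx
  have hden : I.bias * I.scale ≠ 0 := (Nat.mul_pos I.bias_pos I.scale_pos).ne'
  have hout' : ∀ j, j < 2 + 2 * (I.n * I.n) → σ 1 j = I.output j := hout
  refine ⟨σ, T, I.reward, I.config, he, ?_, ?_, fun u v => ?_, I.motivatingForAll_config,
    I.optReward_le_reward, I.reward_le_two_mul⟩
  · simpa [UPBInstance.bits] using hT
  · have h0 : σ 1 0 = 2 * I.opt := hout' 0 (by omega)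
    have h1 : σ 1 (0 + 1) = I.bias * I.scale := by
      have : 0 < I.n * I.n := Nat.mul_pos I.s.pos I.s.pos
      exact hout' 1 (by omega)
    rw [RAM.OutputsRat, h0, h1]
    exact ⟨hden, rfl⟩
  · have hv := v.2
    have hlt : (u : ℕ) * I.n + v < I.n * I.n := by nlinarith [u.2]
    have h0 : σ 1 (2 + 2 * (u * I.n + v)) = I.charge u v * I.bias := by
      rw [hout' _ (by omega), UPBInstance.output, if_neg (by omega), if_neg (by omega),
        show (2 + 2 * ((u : ℕ) * I.n + v) - 2) / 2 = I.n * u + v by rw [mul_comm I.n]; omega,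
        Nat.mul_add_div u.pos, Nat.div_eq_of_lt hv, Nat.mul_add_mod, Nat.mod_eq_of_lt hv, add_zero]
    have h1 : σ 1 (2 + 2 * (u * I.n + v) + 1) = I.bias * I.scale := by
      rw [hout' _ (by omega), UPBInstance.output, if_pos (by omega)]
    rw [RAM.OutputsRat, h0, h1]
    exact ⟨hden, rfl⟩
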